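/- Let $\mathsf M=(S,A,\mathit{Act},\delta,\hat s)$ be a Markov decision process: $S$ and $A$ are finite sets of states and actions, $\mathit{Act}(s)\neq\emptyset$ is the set of actions enabled in $s$, every action is enabled in exactly one state, $\delta(a)$ is a probability distribution on $S$ for every $a\in A$, and $\hat s$ is the initial state. A strategy $\sigma$ maps every history $h\in(SA)^*S$ to a probability distribution on the actions enabled in the last state of $h$. It induces the Markov chain on histories that starts in $\hat s$ and moves from $h$ to $h\,a\,s$ with probability $\sigma(h)(a)\cdot\delta(a)(s)$; its runs are the infinite sequences of histories that start in $\hat s$ and all of whose transitions have positive probability. A run is identified with an infinite sequence $s_0a_0s_1a_1\cdots$, and $\mathbb P^\sigma$ denotes the law of the chain. Suppose that $\mathsf M$ is strongly connected, i.e. that $(S,A)$ is a maximal end component. (An end component is a pair $(T,B)$ with $\emptyset\ne T\subseteq S$ and $B\subseteq\bigcup_{t\in T}\mathit{Act}(t)$ such that $\delta(a)(s')>0$ with $a\in B$ implies $s'\in T$, and any two states of $T$ are joined by a path that uses only states of $T$ and actions of $B$; maximality is with respect to componentwise inclusion.) Let $k,m,n\ge 0$, where $m=0$ if $n=0$. Let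 $S_1,\dots,S_k\subseteq S$ be non-empty, let $r_1,\dots,r_m,q_1,\dots,q_n\colon S\to\mathbb R$ and $v_1,\dots,v_m,u_1,\dots,u_n\in\mathbb R$, and let each symbol $\bowtie$ below be one of $\ge$, $>$, chosen separately for each mean-payoff constraint. The condition $\mathit{Acc}$ holds on a run $s_0a_0s_1a_1\cdots$ if - for every $1\le i\le k$, $s_t\in S_i$ for infinitely many $t$; - for every $1\le j\le m$, $\liminf_{T\to\infty}\frac1T\sum_{t=0}^{T-1}r_j(s_t)\bowtie v_j$; - for every $1\le i\le n$, $\limsup_{T\to\infty}\frac1T\sum_{t=0}^{T-1}q_i(s_t)\bowtie u_i$. Let $L$ be the following system in the real variables $x_{i,a}$ ($1\le i\le n$, $a\in A$), in which each constraint uses the symbol $\bowtie$ of the corresponding part of $\mathit{Acc}$: $$\begin{aligned} \sum_{a\in A}x_{i,a}&=1 && (1\le i\le n),\\ \sum_{a\in A}x_{i,a}\,\delta(a)(s)&=\sum_{a\in\mathit{Act}(s)}x_{i,a} && (s\in S,\ 1\le i\le n),\\ \sum_{s\in S,\,a\in\mathit{Act}(s)}x_{i,a}\,r_j(s)&\bowtie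 v_j && (1\le j\le m,\ 1\le i\le n),\\ \sum_{s\in S,\,a\in\mathit{Act}(s)}x_{i,a}\,q_i(s)&\bowtie u_i && (1\le i\le n). \end{aligned}$$ Then $L$ has a non-negative solution if and only if there are a strategy $\sigma$ and a measurable set $R$ of runs with $\mathbb P^\sigma(R)\neq 0$ such that $\mathit{Acc}$ holds on every $\omega\in R$. Moreover, in this case $\sigma$ and $R$ can be chosen so that $\mathbb P^\sigma(R)=1$. -/

import Mathlib

open MeasureTheory ProbabilityTheory Filter

/-- A finite Markov decision process with state set `S` and action set `A` (finiteness is imposed by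
`Fintype` binders); every action is enabled in exactly one state. -/
structure MDP (S A : Type*) where
  /-- actions enabled in a state -/
  Act : S → Finset A
  act_nonempty : ∀ s, (Act s).Nonempty
  existsUnique_enabled : ∀ a, ∃! s, a ∈ Act s
  /-- distribution of the successor state -/
  δ : A → PMF S
  /-- initial state -/
  init : S

/-- Histories: elements `s₀ a₀ s₁ a₁ ⋯ sₙ` of `(S × A)* × S`. -/
@[ext]
structure Loc (S A : Type*) where
  past : List (S × A)
  last : S

namespace Loc

variable {S A : Type*}

/-- The history `h a s`. -/
def extend (h : Loc S A) (a : A) (s : S) : Loc S A := ⟨h.past ++ [(h.last, a)], s⟩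

instance : MeasurableSpace (Loc S A) := ⊤

instance : DiscreteMeasurableSpace (Loc S A) := ⟨fun _ => trivial⟩

instance [Countable S] [Countable A] : Countable (Loc S A) :=
  Function.Injective.countable (f := fun h : Loc S A => (h.past, h.last))
    (fun _ _ e => Loc.ext (congrArg Prod.fst e) (congrArg Prod.snd e))

end Loc

namespace MDP

variable {S A : Type*}

/-- One step of a path inside `(T, B)`. -/
def StepIn (M : MDP S A) (T : Set S) (B : Set A) (s t : S) : Prop :=
  s ∈ T ∧ t ∈ T ∧ ∃ a ∈ B, a ∈ M.Act s ∧ 0 < M.δ a t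

structure IsEndComponent (M : MDP S A) (T : Set S) (B : Set A) : Prop where
  nonempty : T.Nonempty
  enabled : ∀ a ∈ B, ∃ t ∈ T, a ∈ M.Act t
  closed : ∀ a ∈ B, ∀ s, 0 < M.δ a s → s ∈ T
  connected : ∀ s ∈ T, ∀ t ∈ T, Relation.ReflTransGen (M.StepIn T B) s t

/-- Maximal end components, for the componentwise inclusion order. -/
def IsMEC (M : MDP S A) (T : Set S) (B : Set A) : Prop :=
  Maximal (fun C : Set S × Set A => M.IsEndComponent C.1 C.2) (T, B)

def StronglyConnected (M : MDP S A) : Prop := M.IsMEC Set.univ Set.univ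

/-- History-dependent randomized strategies, which choose among the actions that are enabled in the
last state of the history. -/
structure Strategy (M : MDP S A) where
  choice : Loc S A → PMF A
  enabled : ∀ h, ∀ a ∈ (choice h).support, a ∈ M.Act h.last

/-- The transition function of the induced Markov chain on histories:
`h` moves to `h a s` with probability `σ(h)(a) * δ(a)(s)`. -/
noncomputable def step (M : MDP S A) (σ : M.Strategy) (h : Loc S A) : PMF (Loc S A) :=
  (σ.choice h).bind fun a => (M.δ a).map fun s => h.extend a s

/-- The initial location, i.e. the history that consists of the initial state only. -/
def initLoc (M : MDP S A) : Loc S A := ⟨[], M.init⟩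

/-- The runs of the induced Markov chain. -/
def Runs (M : MDP S A) (σ : M.Strategy) : Set (ℕ → Loc S A) :=
  {ω | ω 0 = M.initLoc ∧ ∀ i, 0 < M.step σ (ω i) (ω (i + 1))}

section Prob

variable [Countable S] [Countable A]

noncomputable def stepKernel (M : MDP S A) (σ : M.Strategy) : Kernel (Loc S A) (Loc S A) where
  toFun h := (M.step σ h).toMeasure
  measurable' := measurable_of_countable _

instance (M : MDP S A) (σ : M.Strategy) : IsMarkovKernel (M.stepKernel σ) :=
  ⟨fun h => inferInstanceAs (IsProbabilityMeasure (M.step σ h).toMeasure)⟩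

/-- The transition kernel at time `n`, which looks only at the location at time `n`. -/
noncomputable def kernelAt (M : MDP S A) (σ : M.Strategy) (n : ℕ) :
    Kernel (Π _ : Finset.Iic n, Loc S A) (Loc S A) :=
  (M.stepKernel σ).comap (fun w => w ⟨n, Finset.mem_Iic.2 le_rfl⟩) (measurable_pi_apply _)

instance (M : MDP S A) (σ : M.Strategy) (n : ℕ) : IsMarkovKernel (M.kernelAt σ n) := by
  unfold kernelAt; infer_instance

/-- The law of the induced Markov chain started in the initial location, as a measure on all
sequences of locations (it is carried by `M.Runs σ`). -/
noncomputable def prob (M : MDP S A) (σ : M.Strategy) : Measure (ℕ → Loc S A) :=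
  Kernel.trajMeasure (X := fun _ => Loc S A) (Measure.dirac M.initLoc) (M.kernelAt σ)

end Prob

end MDP

/-- The comparison of a mean-payoff constraint, `≥` or `>`. -/
inductive Cmp
  | ge
  | gt

def Cmp.Holds : Cmp → ℝ → ℝ → Prop
  | .ge, x, p => x ≥ p
  | .gt, x, p => x > p

/-- Limit inferior of the running averages (used for bounded sequences only). -/
noncomputable def lrInf (f : ℕ → ℝ) : ℝ :=
  liminf (fun i : ℕ => (∑ j ∈ Finset.range i, f j) / (i : ℝ)) atTop

/-- Limit superior of the running averages (used for bounded sequences only). -/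
noncomputable def lrSup (f : ℕ → ℝ) : ℝ :=
  limsup (fun i : ℕ => (∑ j ∈ Finset.range i, f j) / (i : ℝ)) atTop

/-- The data of a conjunction of `k` Büchi constraints `Inf(buchi i)`, `m` constraints
`lrInf(r i) ⋈ v i` and `n` constraints `lrSup(q i) ⋈ u i`; each mean-payoff constraint has its own
comparison. -/
structure AccCond (S : Type*) (k m n : ℕ) where
  buchi : Fin k → Set S
  r : Fin m → S → ℝ
  v : Fin m → ℝ
  cmpInf : Fin m → Cmp
  q : Fin n → S → ℝ
  u : Fin n → ℝ
  cmpSup : Fin n → Cmp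

namespace AccCond

variable {S A : Type*} {k m n : ℕ}

/-- Truth of the condition on a sequence of states. -/
def Sat (acc : AccCond S k m n) (ρ : ℕ → S) : Prop :=
  (∀ i, ∃ᶠ t in atTop, ρ t ∈ acc.buchi i) ∧
  (∀ j, (acc.cmpInf j).Holds (lrInf fun t => acc.r j (ρ t)) (acc.v j)) ∧
  (∀ i, (acc.cmpSup i).Holds (lrSup fun t => acc.q i (ρ t)) (acc.u i))

/-- Non-negative solutions of the linear system: one flow for each limit-superior constraint. -/
structure IsNonnegSolution [Fintype S] [Fintype A] (acc : AccCond S k m n) (M : MDP S A)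
    (x : Fin n → A → ℝ) : Prop where
  nonneg : ∀ i a, 0 ≤ x i a
  total : ∀ i, ∑ a, x i a = 1
  kirchhoff : ∀ i s, ∑ a, x i a * (M.δ a s).toReal = ∑ a ∈ M.Act s, x i a
  reward_inf : ∀ i j, (acc.cmpInf j).Holds (∑ s, ∑ a ∈ M.Act s, x i a * acc.r j s) (acc.v j)
  reward_sup : ∀ i, (acc.cmpSup i).Holds (∑ s, ∑ a ∈ M.Act s, x i a * acc.q i s) (acc.u i)

/-- `R` is a measurable set of runs under `σ`, on all of which the condition holds. -/
structure HoldsOn (acc : AccCond S k m n) (M : MDP S A) (σ : M.Strategy)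
    (R : Set (ℕ → Loc S A)) : Prop where
  runs : R ⊆ M.Runs σ
  measurable : MeasurableSet R
  sat : ∀ ω ∈ R, acc.Sat fun t => (ω t).last

end AccCond

/-! Call a non-negative weight on actions with total one that satisfies the Kirchhoff equations a
flow; a solution of L is one flow for each limit-superior constraint. The probability is confined to
one statement, `ae_isTypical`: almost surely, the counts of states and actions differ from the sums
of their conditional probabilities by O(T^(7/8)). Everything after it is a deterministic argument
about such typical runs.

From runs to solutions: a set of positive probability contains a typical run. For each i, choose
times along which the averages of q_i converge to their limit superior, and pass to a subsequence
along which the action frequencies converge as well. The limit is a flow (`isFlow_of_tendsto`). It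
gives q_i exactly the limit superior, and it gives every r_j at least its limit inferior
(`exists_flow`).

From solutions to strategies: cycle through the n flows in phases of rapidly growing length. Mix
into each flow a vanishing portion of a flow that is positive everywhere (`exists_pos_flow`), so
that all actions are used. A positive flow is played by choosing each enabled action with
probability proportional to its weight. By strong connectedness the flow is the only stationary
weight of that policy up to scaling, and linear algebra makes this quantitative
(`exists_stability_const`), so the counts follow the flow. The stability constants may blow up as
the mixture degenerates, but the phases start so late that the constants stay below T^(1/16)
(`exists_schedule`). At the end of a phase the average is nearly that of its flow, which gives the
limits superior. Every flow respects the r_j constraints, so the limits inferior are respected at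
all times. The strategy succeeds almost surely, which also upgrades positive probability to
probability one. -/

open scoped ENNReal Topology

namespace MDP

/-! ### The law of the induced chain -/

section Law

variable {S A : Type*} [Countable S] [Countable A] (M : MDP S A) (σ : M.Strategy)

instance : IsProbabilityMeasure (M.prob σ) := by
  unfold prob; infer_instance

lemma ae_prob_zero : ∀ᵐ ω ∂(M.prob σ), ω 0 = M.initLoc := by
  let e := (MeasurableEquiv.piUnique fun _ : Finset.Iic 0 => Loc S A).symm
  have hprob : M.prob σ =
      Kernel.traj (X := fun _ => Loc S A) (M.kernelAt σ) 0 (e M.initLoc) := by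
    have hd : (Measure.dirac M.initLoc).map e = Measure.dirac (e M.initLoc) :=
      Measure.map_dirac' e.measurable _
    change Measure.bind ((Measure.dirac M.initLoc).map e) _ = _
    rw [hd, Measure.dirac_bind (Kernel.measurable _)]
  rw [hprob]
  have hmap := Kernel.traj_map_frestrictLe_apply (X := fun _ => Loc S A) (κ := M.kernelAt σ) 0 0
    ((MeasurableEquiv.piUnique fun _ : Finset.Iic 0 => Loc S A).symm M.initLoc)
  rw [Kernel.partialTraj_self, Kernel.id_apply] at hmap
  have key : ∀ᵐ w ∂((Kernel.traj (X := fun _ => Loc S A) (M.kernelAt σ) 0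
      ((MeasurableEquiv.piUnique fun _ : Finset.Iic 0 => Loc S A).symm M.initLoc)).map
        (Preorder.frestrictLe 0)), w ⟨0, by simp⟩ = M.initLoc := by
    rw [hmap, ae_dirac_iff]
    · rfl
    · exact measurableSet_eq_fun (measurable_pi_apply _) measurable_const
  exact ae_of_ae_map (by fun_prop) key

/-- The joint law of the locations up to time `t` and of the location at time `t + 1`. -/
lemma map_prob_succ (t : ℕ) :
    (M.prob σ).map (fun ω => (Preorder.frestrictLe (π := fun _ => Loc S A) t ω, ω (t + 1))) =
      ((M.prob σ).map (Preorder.frestrictLe t)).compProd (M.kernelAt σ t) :=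
  (Kernel.map_frestrictLe_trajMeasure_compProd_eq_map_trajMeasure (X := fun _ => Loc S A)).symm

lemma ae_prob_step (t : ℕ) : ∀ᵐ ω ∂(M.prob σ), 0 < M.step σ (ω t) (ω (t + 1)) := by
  have hmeas : MeasurableSet {p : (Π _ : Finset.Iic t, Loc S A) × Loc S A |
      0 < M.step σ (p.1 ⟨t, Finset.mem_Iic.2 le_rfl⟩) p.2} := by
    have : Measurable fun p : (Π _ : Finset.Iic t, Loc S A) × Loc S A =>
        (p.1 ⟨t, Finset.mem_Iic.2 le_rfl⟩, p.2) := by fun_prop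
    exact this (MeasurableSet.of_discrete (s := {p : Loc S A × Loc S A | 0 < M.step σ p.1 p.2}))
  have key : ∀ᵐ p ∂((M.prob σ).map
      (fun ω => (Preorder.frestrictLe (π := fun _ => Loc S A) t ω, ω (t + 1)))),
      0 < M.step σ (p.1 ⟨t, Finset.mem_Iic.2 le_rfl⟩) p.2 := by
    rw [map_prob_succ, Measure.ae_compProd_iff hmeas]
    refine Eventually.of_forall fun w => ?_
    have hsupp : (M.step σ (w ⟨t, Finset.mem_Iic.2 le_rfl⟩)).toMeasure
        (M.step σ (w ⟨t, Finset.mem_Iic.2 le_rfl⟩)).supportᶜ = 0 := by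
      rw [PMF.toMeasure_apply_eq_zero_iff _ MeasurableSet.of_discrete]
      exact disjoint_compl_right
    refine measure_mono_null (fun h hh => ?_) hsupp
    simpa [PMF.mem_support_iff] using hh
  have hφ : Measurable fun ω : ℕ → Loc S A =>
      (Preorder.frestrictLe (π := fun _ => Loc S A) t ω, ω (t + 1)) := by fun_prop
  exact ae_of_ae_map hφ.aemeasurable key

lemma ae_mem_runs : ∀ᵐ ω ∂(M.prob σ), ω ∈ M.Runs σ := by
  filter_upwards [M.ae_prob_zero σ, ae_all_iff.2 (M.ae_prob_step σ)] with ω h0 h1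
  exact ⟨h0, h1⟩

/-- A bounded increment that is centred given the present is orthogonal to the past. -/
lemma integral_past_mul_increment {f : Loc S A → Loc S A → ℝ} {c : ℝ}
    (hf : ∀ h h', |f h h'| ≤ c) (hf0 : ∀ h, ∫ h', f h h' ∂(M.step σ h).toMeasure = 0)
    {t : ℕ} {G : (ℕ → Loc S A) → ℝ} (hG : Measurable G) {b : ℝ} (hGb : ∀ ω, |G ω| ≤ b)
    (hpast : ∀ ω ω', (∀ i ≤ t, ω i = ω' i) → G ω = G ω') :
    ∫ ω, G ω * f (ω t) (ω (t + 1)) ∂(M.prob σ) = 0 := by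
  -- The joint law lives on finite paths, while `G` takes infinite sequences. The padding value is
  -- arbitrary, since `hpast` makes `G` blind to it.
  let ext : (Π _ : Finset.Iic t, Loc S A) → ℕ → Loc S A :=
    fun w i => if h : i ≤ t then w ⟨i, Finset.mem_Iic.2 h⟩ else M.initLoc
  have hext : Measurable ext := by
    refine measurable_pi_lambda _ fun i => ?_
    by_cases h : i ≤ t
    · simp only [ext, h, dite_true]; fun_prop
    · simp only [ext, h, dite_false]; fun_prop
  let F : (Π _ : Finset.Iic t, Loc S A) × Loc S A → ℝ :=
    fun p => G (ext p.1) * f (p.1 ⟨t, Finset.mem_Iic.2 le_rfl⟩) p.2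
  have hFm : Measurable F := by
    have h2 : Measurable fun p : (Π _ : Finset.Iic t, Loc S A) × Loc S A =>
        (p.1 ⟨t, Finset.mem_Iic.2 le_rfl⟩, p.2) := by fun_prop
    have h3 : Measurable fun p : Loc S A × Loc S A => f p.1 p.2 := measurable_of_countable _
    exact (hG.comp (hext.comp measurable_fst)).mul (h3.comp h2)
  have hFb : ∀ p, ‖F p‖ ≤ b * c := fun p => by
    rw [Real.norm_eq_abs, abs_mul]
    exact mul_le_mul (hGb _) (hf _ _) (abs_nonneg _) ((abs_nonneg _).trans (hGb (ext p.1)))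
  have heq : ∀ ω : ℕ → Loc S A, G ω * f (ω t) (ω (t + 1)) =
      F (Preorder.frestrictLe (π := fun _ => Loc S A) t ω, ω (t + 1)) := by
    intro ω
    change _ = G _ * _
    congr 1
    refine hpast _ _ fun i hi => ?_
    simp [ext, hi]
  simp_rw [heq]
  have hφ : Measurable fun ω : ℕ → Loc S A =>
      (Preorder.frestrictLe (π := fun _ => Loc S A) t ω, ω (t + 1)) := by fun_prop
  rw [← integral_map (f := F) hφ.aemeasurable hFm.aestronglyMeasurable, map_prob_succ]
  have : IsProbabilityMeasure
      ((M.prob σ).map (Preorder.frestrictLe (π := fun _ => Loc S A) t)) :=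
    Measure.isProbabilityMeasure_map (by fun_prop)
  rw [Measure.integral_compProd
    (Integrable.of_bound hFm.aestronglyMeasurable (b * c) (Eventually.of_forall hFb))]
  refine integral_eq_zero_of_ae (Eventually.of_forall fun w => ?_)
  change ∫ h', G (ext w) * f (w ⟨t, _⟩) h' ∂(M.step σ (w ⟨t, _⟩)).toMeasure = 0
  rw [integral_const_mul, hf0, mul_zero]

end Law

end MDP

/-! ### Moments and growth of sums of centred increments -/

namespace MDP

section Noise

variable {S A : Type*}

/-- The sum of the first `T` increments of `f` along `ω`. -/
def noise (f : Loc S A → Loc S A → ℝ) (T : ℕ) (ω : ℕ → Loc S A) : ℝ :=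
  ∑ t ∈ Finset.range T, f (ω t) (ω (t + 1))

lemma noise_succ (f : Loc S A → Loc S A → ℝ) (T : ℕ) (ω : ℕ → Loc S A) :
    noise f (T + 1) ω = noise f T ω + f (ω T) (ω (T + 1)) := Finset.sum_range_succ _ _

lemma noise_congr (f : Loc S A → Loc S A → ℝ) (T : ℕ) (ω ω' : ℕ → Loc S A)
    (h : ∀ i ≤ T, ω i = ω' i) : noise f T ω = noise f T ω' := by
  refine Finset.sum_congr rfl fun t ht => ?_
  have := Finset.mem_range.1 ht
  rw [h t (by omega), h (t + 1) (by omega)]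

lemma abs_noise_le {f : Loc S A → Loc S A → ℝ} (hf : ∀ h h', |f h h'| ≤ 1) (T : ℕ)
    (ω : ℕ → Loc S A) :
    |noise f T ω| ≤ T := by
  refine (Finset.abs_sum_le_sum_abs _ _).trans ?_
  refine (Finset.sum_le_sum fun t _ => hf _ _).trans ?_
  simp

variable [Countable S] [Countable A]

lemma measurable_noise (f : Loc S A → Loc S A → ℝ) (T : ℕ) : Measurable (noise f T) := by
  have h3 : Measurable fun p : Loc S A × Loc S A => f p.1 p.2 := measurable_of_countable _
  refine Finset.measurable_sum _ fun t _ => ?_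
  exact h3.comp (f := fun ω : ℕ → Loc S A => (ω t, ω (t + 1))) (by fun_prop)

variable (M : MDP S A) (σ : M.Strategy) {f : Loc S A → Loc S A → ℝ}

lemma integrable_noise_pow (hf : ∀ h h', |f h h'| ≤ 1) (T p : ℕ) :
    Integrable (fun ω => noise f T ω ^ p) (M.prob σ) := by
  refine Integrable.of_bound ((measurable_noise f T).pow_const p).aestronglyMeasurable
    ((T : ℝ) ^ p) (Eventually.of_forall fun ω => ?_)
  rw [norm_pow, Real.norm_eq_abs]
  exact pow_le_pow_left₀ (abs_nonneg _) (abs_noise_le hf T ω) p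

lemma integral_noise_pow_mul (hf : ∀ h h', |f h h'| ≤ 1)
    (hf0 : ∀ h, ∫ h', f h h' ∂(M.step σ h).toMeasure = 0) (T p : ℕ) :
    ∫ ω, noise f T ω ^ p * f (ω T) (ω (T + 1)) ∂(M.prob σ) = 0 := by
  refine M.integral_past_mul_increment σ hf hf0 ((measurable_noise f T).pow_const p)
    (b := (T : ℝ) ^ p) (fun ω => ?_) fun ω ω' h => by rw [noise_congr f T ω ω' h]
  rw [abs_pow]
  exact pow_le_pow_left₀ (abs_nonneg _) (abs_noise_le hf T ω) p

lemma integrable_noise_pow_mul (hf : ∀ h h', |f h h'| ≤ 1) (T p : ℕ) :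
    Integrable (fun ω => noise f T ω ^ p * f (ω T) (ω (T + 1))) (M.prob σ) := by
  have h3 : Measurable fun p : Loc S A × Loc S A => f p.1 p.2 := measurable_of_countable _
  refine (M.integrable_noise_pow σ hf T p).mul_bdd (c := 1)
    (h3.comp (f := fun ω : ℕ → Loc S A => (ω T, ω (T + 1))) (by fun_prop)).aestronglyMeasurable
    (Eventually.of_forall fun ω => hf _ _)

/-- Increments are orthogonal to the past, so each step adds at most the second moment of one
increment. -/
lemma integral_noise_sq_le (hf : ∀ h h', |f h h'| ≤ 1)
    (hf0 : ∀ h, ∫ h', f h h' ∂(M.step σ h).toMeasure = 0) (T : ℕ) :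
    ∫ ω, noise f T ω ^ 2 ∂(M.prob σ) ≤ T := by
  induction T with
  | zero => simp [noise]
  | succ T ih =>
    have hle : ∀ ω, noise f (T + 1) ω ^ 2 ≤
        noise f T ω ^ 2 + 2 * (noise f T ω ^ 1 * f (ω T) (ω (T + 1))) + 1 := fun ω => by
      have h1 : f (ω T) (ω (T + 1)) ^ 2 ≤ 1 := (sq_le_one_iff_abs_le_one _).2 (hf _ _)
      rw [noise_succ]; nlinarith
    have i2 := M.integrable_noise_pow σ hf T 2
    have i1 := (M.integrable_noise_pow_mul σ hf T 1).const_mul 2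
    refine (integral_mono (M.integrable_noise_pow σ hf (T + 1) 2)
      ((i2.add i1).add (integrable_const (1 : ℝ))) hle).trans ?_
    rw [integral_add' (i2.add i1) (integrable_const (1 : ℝ)), integral_add' i2 i1,
      integral_const_mul,
      M.integral_noise_pow_mul σ hf hf0]
    simp; linarith

lemma integral_noise_pow_four_le (hf : ∀ h h', |f h h'| ≤ 1)
    (hf0 : ∀ h, ∫ h', f h h' ∂(M.step σ h).toMeasure = 0) (T : ℕ) :
    ∫ ω, noise f T ω ^ 4 ∂(M.prob σ) ≤ 4 * (T : ℝ) ^ 2 := by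
  induction T with
  | zero => simp [noise]
  | succ T ih =>
    -- Expand (x + y)^4. Only 4x³y is centred; 6x²y² is at most 6x², 4xy³ at most 2x² + 2, and y⁴ at
    -- most 1. With the bound on second moments, 4T² + 8T + 3 ≤ 4(T + 1)² closes the induction.
    have hle : ∀ ω, noise f (T + 1) ω ^ 4 ≤
        noise f T ω ^ 4 + 4 * (noise f T ω ^ 3 * f (ω T) (ω (T + 1)))
          + 8 * noise f T ω ^ 2 + 3 := fun ω => by
      have h0 := hf (ω T) (ω (T + 1))
      rw [noise_succ]
      generalize noise f T ω = x at *
      generalize f (ω T) (ω (T + 1)) = y at *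
      have h1 : y ^ 2 ≤ 1 := (sq_le_one_iff_abs_le_one _).2 h0
      have h2 : 0 ≤ y ^ 2 := sq_nonneg y
      have h4 : y ^ 4 ≤ 1 := by nlinarith
      have h5 : y ^ 6 ≤ 1 := by nlinarith
      have h6 : 2 * (x * y ^ 3) ≤ x ^ 2 + 1 := by nlinarith [sq_nonneg (x - y ^ 3)]
      have h7 : x ^ 2 * y ^ 2 ≤ x ^ 2 := mul_le_of_le_one_right (sq_nonneg x) h1
      nlinarith
    have i4 := M.integrable_noise_pow σ hf T 4
    have i2 := (M.integrable_noise_pow σ hf T 2).const_mul 8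
    have i3 := (M.integrable_noise_pow_mul σ hf T 3).const_mul 4
    refine (integral_mono (M.integrable_noise_pow σ hf (T + 1) 4)
      (((i4.add i3).add i2).add (integrable_const (3 : ℝ))) hle).trans ?_
    have hsq := M.integral_noise_sq_le σ hf hf0 T
    rw [integral_add' ((i4.add i3).add i2) (integrable_const (3 : ℝ)),
      integral_add' (i4.add i3) i2, integral_add' i4 i3, integral_const_mul,
      integral_const_mul, M.integral_noise_pow_mul σ hf hf0]
    simp; nlinarith

/-- Almost surely, centred bounded increments have sums of order `T ^ (7/8)`. -/
lemma ae_noise_le (hf : ∀ h h', |f h h'| ≤ 1)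
    (hf0 : ∀ h, ∫ h', f h h' ∂(M.step σ h).toMeasure = 0) :
    ∀ᵐ ω ∂(M.prob σ), ∃ B : ℝ, 0 ≤ B ∧ ∀ T : ℕ, |noise f T ω| ≤ B * (T : ℝ) ^ (7 / 8 : ℝ) := by
  -- Since 7/2 = 4 · 7/8, a bound on `g` is the wanted one. Its expectation is O(T^(-3/2)), so the
  -- sum over `T` is almost surely finite and bounds every term.
  let g : ℕ → (ℕ → Loc S A) → ℝ := fun T ω => noise f T ω ^ 4 / (T : ℝ) ^ (7 / 2 : ℝ)
  have hg0 : ∀ T ω, 0 ≤ g T ω := fun T ω => by positivity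
  have hgm : ∀ T, Measurable (g T) := fun T => ((measurable_noise f T).pow_const 4).div_const _
  have hgi : ∀ T, ∫ ω, g T ω ∂(M.prob σ) ≤ 4 * (1 / (T : ℝ) ^ (3 / 2 : ℝ)) := fun T => by
    simp only [g]
    rw [integral_div]
    rcases Nat.eq_zero_or_pos T with rfl | hT
    · simp [noise]
    have hT' : (0 : ℝ) < T := by exact_mod_cast hT
    have hsplit : (T : ℝ) ^ (7 / 2 : ℝ) = (T : ℝ) ^ 2 * (T : ℝ) ^ (3 / 2 : ℝ) := by
      rw [← Real.rpow_natCast, ← Real.rpow_add hT']; norm_num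
    rw [hsplit, div_le_iff₀ (by positivity)]
    have := M.integral_noise_pow_four_le σ hf hf0 T
    have h2 : (T : ℝ) ^ (3 / 2 : ℝ) ≠ 0 := by positivity
    field_simp
    linarith
  have hsum : Summable fun T : ℕ => 4 * (1 / (T : ℝ) ^ (3 / 2 : ℝ)) :=
    (Real.summable_one_div_nat_rpow.2 (by norm_num)).mul_left 4
  have hlin : ∫⁻ ω, ∑' T, ENNReal.ofReal (g T ω) ∂(M.prob σ) ≠ ∞ := by
    rw [lintegral_tsum fun T => (hgm T).ennreal_ofReal.aemeasurable]
    refine ne_top_of_le_ne_top hsum.tsum_ofReal_ne_top (ENNReal.tsum_le_tsum fun T => ?_)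
    rw [← ofReal_integral_eq_lintegral_ofReal ((M.integrable_noise_pow σ hf T 4).div_const _)
      (Eventually.of_forall (hg0 T))]
    exact ENNReal.ofReal_le_ofReal (hgi T)
  filter_upwards [ae_lt_top (Measurable.tsum fun T => (hgm T).ennreal_ofReal) hlin]
    with ω hω
  set K := (∑' T, ENNReal.ofReal (g T ω)).toReal with hK
  have hgK : ∀ T, g T ω ≤ K := fun T => by
    rw [← ENNReal.toReal_ofReal (hg0 T ω)]
    exact ENNReal.toReal_mono hω.ne (ENNReal.le_tsum T)
  -- A number that is at least 1 and at least `K` has fourth power at least `K`, which avoids a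
  -- fourth root.
  refine ⟨max 1 K, by positivity, fun T => ?_⟩
  rcases Nat.eq_zero_or_pos T with rfl | hT
  · simp [noise]
  have hT' : (0 : ℝ) < T := by exact_mod_cast hT
  refine le_of_pow_le_pow_left₀ (n := 4) (by norm_num) (by positivity) ?_
  rw [mul_pow, ← Real.rpow_natCast ((T : ℝ) ^ (7 / 8 : ℝ)), ← Real.rpow_mul hT'.le]
  have h1 := (div_le_iff₀ (by positivity)).1 (hgK T)
  have h2 : K ≤ max 1 K ^ 4 :=
    (le_max_right 1 K).trans (le_self_pow₀ (le_max_left _ _) (by norm_num))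
  have h3 : |noise f T ω| ^ 4 = noise f T ω ^ 4 := by
    rw [← abs_pow, abs_of_nonneg (by positivity)]
  rw [h3, show (7 / 8 : ℝ) * ((4 : ℕ) : ℝ) = 7 / 2 by norm_num]
  exact h1.trans (mul_le_mul_of_nonneg_right h2 (by positivity))

end Noise

section Step

variable {S A : Type*} [Fintype S] [Fintype A] (M : MDP S A) (σ : M.Strategy)

lemma toMeasure_step (h : Loc S A) :
    (M.step σ h).toMeasure = ∑ a, ∑ s, (σ.choice h a * M.δ a s) • Measure.dirac (h.extend a s) := by
  classical
  ext E hE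
  let : MeasurableSpace A := ⊤
  let : MeasurableSpace S := ⊤
  unfold step
  rw [PMF.toMeasure_bind_apply _ _ _ hE, tsum_fintype]
  simp only [Measure.coe_finsetSum, Finset.sum_apply, Measure.smul_apply, smul_eq_mul]
  refine Finset.sum_congr rfl fun a _ => ?_
  rw [PMF.toMeasure_map_apply _ _ _ measurable_from_top hE, PMF.toMeasure_apply_fintype,
    Finset.mul_sum]
  refine Finset.sum_congr rfl fun s _ => ?_
  rw [Measure.dirac_apply' _ hE, mul_assoc]
  congr 1
  by_cases hs : h.extend a s ∈ E <;> simp [Set.indicator, hs]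

lemma integral_step (h : Loc S A) (g : Loc S A → ℝ) :
    ∫ h', g h' ∂(M.step σ h).toMeasure =
      ∑ a, (σ.choice h a).toReal * ∑ s, (M.δ a s).toReal * g (h.extend a s) := by
  rw [toMeasure_step]
  have hi : ∀ a s, Integrable g ((σ.choice h a * M.δ a s) • Measure.dirac (h.extend a s)) :=
    fun a s => (integrable_dirac (by simp)).smul_measure
      (ENNReal.mul_ne_top (PMF.apply_ne_top _ _) (PMF.apply_ne_top _ _))
  rw [integral_finsetSum_measure
    fun a _ => integrable_finsetSum_measure.2 fun s _ => hi a s]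
  refine Finset.sum_congr rfl fun a _ => ?_
  rw [integral_finsetSum_measure fun s _ => hi a s, Finset.mul_sum]
  refine Finset.sum_congr rfl fun s _ => ?_
  rw [integral_smul_measure, integral_dirac, ENNReal.toReal_mul, smul_eq_mul, mul_assoc]

end Step

end MDP

lemma PMF.toReal_apply_le_one {α : Type*} (p : PMF α) (a : α) : (p a).toReal ≤ 1 :=
  ENNReal.toReal_le_of_le_ofReal zero_le_one (by simpa using PMF.coe_le_one _ _)

lemma PMF.sum_toReal_apply {α : Type*} [Fintype α] (p : PMF α) :
    ∑ a, (p a).toReal = 1 := by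
  rw [← ENNReal.toReal_sum fun s _ => PMF.apply_ne_top _ _,
    ← tsum_fintype (L := .unconditional α), PMF.tsum_coe]
  rfl

/-! ### Flows: existence, uniqueness for a policy, and stability -/

namespace MDP

section Flow

variable {S A : Type*} (M : MDP S A)

/-- The state in which an action is enabled. -/
noncomputable def src (a : A) : S := (M.existsUnique_enabled a).choose

lemma mem_act_iff {a : A} {s : S} : a ∈ M.Act s ↔ M.src a = s :=
  ⟨fun h => ((M.existsUnique_enabled a).choose_spec.2 s h).symm,
    fun h => h ▸ (M.existsUnique_enabled a).choose_spec.1⟩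

lemma mem_act_src (a : A) : a ∈ M.Act (M.src a) := M.mem_act_iff.2 rfl

/-- The total weight of the actions enabled in `s`. -/
def mass (x : A → ℝ) (s : S) : ℝ := ∑ a ∈ M.Act s, x a

lemma mass_pos {x : A → ℝ} (hx : ∀ a, 0 < x a) (s : S) : 0 < M.mass x s :=
  Finset.sum_pos (fun a _ => hx a) (M.act_nonempty s)

/-- The sets of enabled actions partition `A`. This turns the double sums of the linear system into
sums over actions. -/
lemma sum_act [Fintype S] [Fintype A] (F : A → S → ℝ) :
    ∑ s, ∑ a ∈ M.Act s, F a s = ∑ a, F a (M.src a) := by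
  classical
  have h : ∀ s, ∑ a ∈ M.Act s, F a s = ∑ a, if M.src a = s then F a s else 0 := fun s => by
    rw [← Finset.sum_filter]
    refine Finset.sum_congr ?_ fun _ _ => rfl
    ext a; simp [mem_act_iff]
  simp_rw [h]
  rw [Finset.sum_comm]
  simp

/-- Induction along a path from `s₀`. It serves for the positivity of stationary weights and for the
maximum principle. -/
lemma StronglyConnected.induction {M : MDP S A} (hM : M.StronglyConnected) {p : S → Prop} {s₀ : S}
    (h₀ : p s₀)
    (hstep : ∀ a t, p (M.src a) → 0 < (M.δ a t).toReal → p t) (s : S) : p s := by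
  have h := (Maximal.prop (P := fun C : Set S × Set A => M.IsEndComponent C.1 C.2) hM).connected
    s₀ trivial s trivial
  induction h with
  | refl => exact h₀
  | tail _ hst ih =>
    obtain ⟨-, -, a, -, ha, hpos⟩ := hst
    refine hstep a _ (by rwa [M.mem_act_iff.1 ha]) ?_
    exact ENNReal.toReal_pos hpos.ne' (PMF.apply_ne_top _ _)

variable [Fintype A]

/-- Stationary distributions on the actions. -/
structure IsFlow (x : A → ℝ) : Prop where
  nonneg : ∀ a, 0 ≤ x a
  total : ∑ a, x a = 1
  kirchhoff : ∀ s, ∑ a, x a * (M.δ a s).toReal = M.mass x s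

variable {M}

lemma IsFlow.convex {x y : A → ℝ} (hx : M.IsFlow x) (hy : M.IsFlow y) {c : ℝ} (h0 : 0 ≤ c)
    (h1 : c ≤ 1) : M.IsFlow fun a => (1 - c) * x a + c * y a where
  nonneg a := add_nonneg (mul_nonneg (by linarith) (hx.nonneg a)) (mul_nonneg h0 (hy.nonneg a))
  total := by
    rw [Finset.sum_add_distrib, ← Finset.mul_sum, ← Finset.mul_sum, hx.total, hy.total]; ring
  kirchhoff s := by
    have h1 := hx.kirchhoff s
    have h2 := hy.kirchhoff s
    simp only [mass, add_mul, Finset.sum_add_distrib, mul_assoc, ← Finset.mul_sum] at h1 h2 ⊢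
    rw [h1, h2]

variable [Fintype S]

/-- Take the stationary distribution of the policy that chooses uniformly among the enabled actions,
and split the weight of each state evenly; connectedness makes it positive. -/
lemma StronglyConnected.exists_pos_flow (hM : M.StronglyConnected) :
    ∃ x, M.IsFlow x ∧ ∀ a, 0 < x a := by
  classical
  let d : S → ℝ := fun s => ((M.Act s).card : ℝ)
  have hd : ∀ s, 0 < d s := fun s =>
    Nat.cast_pos.2 (Finset.card_pos.2 (M.act_nonempty s))
  let P : Matrix S S ℝ := fun s t => ∑ a ∈ M.Act s, (M.δ a t).toReal / d s
  have hP0 : ∀ s t, 0 ≤ P s t := fun s t =>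
    Finset.sum_nonneg fun a _ => div_nonneg ENNReal.toReal_nonneg (hd s).le
  have hP1 : ∀ s, ∑ t, P s t = 1 := fun s => by
    simp only [P]
    rw [Finset.sum_comm]
    simp_rw [← Finset.sum_div, PMF.sum_toReal_apply]
    rw [Finset.sum_const, nsmul_eq_mul, mul_one]
    exact div_self (hd s).ne'
  -- Rows sum to one, so `P - 1` is singular and also has a left null vector `v`. The inequality |v|
  -- ≤ |v|P is an equality because both sides have the same total, hence |v| is stationary.
  have hker : (P - 1).mulVec 1 = 0 := by
    ext s
    have := hP1 s
    rw [Matrix.sub_mulVec, Matrix.one_mulVec]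
    simp [Matrix.mulVec, dotProduct, this]
  obtain ⟨v, hv0, hv⟩ := Matrix.exists_vecMul_eq_zero_iff.2 (Matrix.exists_mulVec_eq_zero_iff.1
    ⟨1, fun h => one_ne_zero (α := ℝ) (congrFun h M.init), hker⟩)
  have hvP : ∀ t, ∑ s, v s * P s t = v t := fun t => by
    have := congrFun hv t
    rw [Matrix.vecMul_sub, Matrix.vecMul_one] at this
    exact sub_eq_zero.1 this
  have hle : ∀ t, |v t| ≤ ∑ s, |v s| * P s t := fun t => by
    rw [← hvP t]
    refine (Finset.abs_sum_le_sum_abs _ _).trans (le_of_eq ?_)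
    exact Finset.sum_congr rfl fun s _ => by rw [abs_mul, abs_of_nonneg (hP0 s t)]
  have hsum : ∑ t, ∑ s, |v s| * P s t = ∑ t, |v t| := by
    rw [Finset.sum_comm]
    simp_rw [← Finset.mul_sum, hP1, mul_one]
  have hw : ∀ t, |v t| = ∑ s, |v s| * P s t := fun t =>
    (Finset.sum_eq_sum_iff_of_le fun t _ => hle t).1 hsum.symm t (Finset.mem_univ t)
  obtain ⟨s₀, hs₀⟩ := Function.ne_iff.1 hv0
  have hpos : ∀ s, 0 < |v s| := by
    refine hM.induction (s₀ := s₀) (abs_pos.2 hs₀) fun a t h ht => ?_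
    rw [hw t]
    refine Finset.sum_pos' (fun s _ => mul_nonneg (abs_nonneg _) (hP0 s t))
      ⟨M.src a, Finset.mem_univ _, mul_pos h ?_⟩
    exact Finset.sum_pos' (fun a _ => div_nonneg ENNReal.toReal_nonneg (hd _).le)
      ⟨a, M.mem_act_src a, div_pos ht (hd _)⟩
  set W := ∑ s, |v s| with hW
  have hWpos : 0 < W := Finset.sum_pos (fun s _ => hpos s) ⟨M.init, Finset.mem_univ _⟩
  let x : A → ℝ := fun a => |v (M.src a)| / d (M.src a) / W
  have hxpos : ∀ a, 0 < x a := fun a => div_pos (div_pos (hpos _) (hd _)) hWpos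
  have hmass : ∀ s, M.mass x s = |v s| / W := fun s => by
    have : ∀ a ∈ M.Act s, x a = |v s| / d s / W := fun a ha => by
      simp only [x]; rw [M.mem_act_iff.1 ha]
    rw [mass, Finset.sum_congr rfl this, Finset.sum_const, nsmul_eq_mul]
    have := (hd s).ne'
    change d s * _ = _
    field_simp
  refine ⟨x, ⟨fun a => (hxpos a).le, ?_, fun t => ?_⟩, hxpos⟩
  · rw [← M.sum_act fun a _ => x a]
    change ∑ s, M.mass x s = 1
    simp_rw [hmass]
    rw [← Finset.sum_div, div_self hWpos.ne']
  · rw [hmass, hw t, ← M.sum_act fun a s => |v s| / d s / W * (M.δ a t).toReal, Finset.sum_div]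
    refine Finset.sum_congr rfl fun s _ => ?_
    simp only [P]
    rw [Finset.mul_sum, Finset.sum_div]
    exact Finset.sum_congr rfl fun a _ => by ring

/-- For a positive flow `x`, the Kirchhoff equations and the conditional action probabilities
determine a weight of total mass zero. -/
lemma StronglyConnected.eq_zero_of_stationary (hM : M.StronglyConnected) {x : A → ℝ}
    (hx : M.IsFlow x) (hpos : ∀ a, 0 < x a) {y : A → ℝ}
    (hkir : ∀ s, ∑ a, y a * (M.δ a s).toReal = M.mass y s)
    (hpol : ∀ a, y a = x a / M.mass x (M.src a) * M.mass y (M.src a)) (htot : ∑ a, y a = 0) :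
    y = 0 := by
  let c : S → ℝ := fun s => M.mass y s / M.mass x s
  have hyc : ∀ a, y a = c (M.src a) * x a := fun a => by rw [hpol a]; ring
  have hne : Nonempty S := ⟨M.init⟩
  obtain ⟨s₀, hs₀⟩ := Finite.exists_max c
  -- Maximum principle: by Kirchhoff, `c t` is a weighted mean of the values at the sources of
  -- incoming actions. Being below the maximum thus passes to successors, and would finally reach
  -- the maximiser `s₀`.
  have hback : ∀ a, c (M.src a) < c s₀ → ∀ t, 0 < (M.δ a t).toReal → c t < c s₀ := by
    intro a ha t ht
    have h1 : M.mass y t = c t * M.mass x t := (div_mul_cancel₀ _ (M.mass_pos hpos t).ne').symm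
    rw [← hkir, ← hx.kirchhoff] at h1
    have h2 : ∑ a, y a * (M.δ a t).toReal < ∑ a, c s₀ * (x a * (M.δ a t).toReal) := by
      refine Finset.sum_lt_sum (fun b _ => ?_) ⟨a, Finset.mem_univ _, ?_⟩
      · rw [hyc b, mul_assoc]
        exact mul_le_mul_of_nonneg_right (hs₀ _) (mul_nonneg (hpos b).le ENNReal.toReal_nonneg)
      · rw [hyc a, mul_assoc]
        exact mul_lt_mul_of_pos_right ha (mul_pos (hpos a) ht)
    rw [h1, ← Finset.mul_sum, hx.kirchhoff] at h2
    exact lt_of_mul_lt_mul_right h2 (M.mass_pos hpos t).le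
  have hconst : ∀ s, c s = c s₀ := fun s => by
    by_contra hs
    exact lt_irrefl _ (hM.induction (p := fun t => c t < c s₀) (lt_of_le_of_ne (hs₀ s) hs)
      (fun a t h ht => hback a h t ht) s₀)
  have hy : ∀ a, y a = c s₀ * x a := fun a => by rw [hyc a, hconst]
  have hc0 : c s₀ = 0 := by
    simp_rw [hy] at htot
    rwa [← Finset.mul_sum, hx.total, mul_one] at htot
  ext a
  simp [hy a, hc0]

/-- Quantitative form of `eq_zero_of_stationary`. -/
lemma StronglyConnected.exists_stability_const (hM : M.StronglyConnected) {x : A → ℝ}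
    (hx : M.IsFlow x) (hpos : ∀ a, 0 < x a) :
    ∃ C : ℝ, 0 < C ∧ ∀ (y : A → ℝ) (e : ℝ),
      (∀ s, |∑ a, y a * (M.δ a s).toReal - M.mass y s| ≤ e) →
      (∀ a, |y a - x a / M.mass x (M.src a) * M.mass y (M.src a)| ≤ e) → ∑ a, y a = 0 →
      ∀ a, |y a| ≤ C * e := by
  -- Kirchhoff defect, policy defect and total mass. An injective linear map in finite dimension is
  -- antilipschitz, and the sup norms turn this into the entrywise bounds.
  let Φ : (A → ℝ) →ₗ[ℝ] (S → ℝ) × (A → ℝ) × ℝ :=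
    { toFun := fun y => (fun s => ∑ a, y a * (M.δ a s).toReal - M.mass y s,
        fun a => y a - x a / M.mass x (M.src a) * M.mass y (M.src a), ∑ a, y a)
      map_add' := fun y z => by
        simp only [mass, Pi.add_apply, add_mul, Finset.sum_add_distrib, mul_add, Prod.mk_add_mk]
        refine Prod.ext (funext fun s => ?_) (Prod.ext (funext fun a => ?_) rfl)
        · simp only [Pi.add_apply]; ring
        · simp only [Pi.add_apply]; ring
      map_smul' := fun r y => by
        simp only [mass, Pi.smul_apply, smul_eq_mul, mul_assoc, ← Finset.mul_sum, RingHom.id_apply,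
          Prod.smul_mk]
        refine Prod.ext (funext fun s => ?_) (Prod.ext (funext fun a => ?_) rfl)
        · simp only [Pi.smul_apply, smul_eq_mul]; ring
        · simp only [Pi.smul_apply, smul_eq_mul]; ring }
  have hker : LinearMap.ker Φ = ⊥ := by
    refine (LinearMap.ker_eq_bot').2 fun y hy => ?_
    have h1 := congrArg Prod.fst hy
    have h2 := congrArg (fun p => p.2.1) hy
    have h3 := congrArg (fun p => p.2.2) hy
    exact hM.eq_zero_of_stationary hx hpos (fun s => sub_eq_zero.1 (congrFun h1 s))
      (fun a => sub_eq_zero.1 (congrFun h2 a)) h3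
  obtain ⟨K, hK, hanti⟩ := Φ.exists_antilipschitzWith hker
  refine ⟨K, hK, fun y e h1 h2 h3 a => ?_⟩
  have he : 0 ≤ e := (abs_nonneg _).trans (h1 M.init)
  have h := hanti.le_mul_dist y 0
  rw [map_zero, dist_zero_right, dist_zero_right] at h
  refine (norm_le_pi_norm y a).trans (h.trans (mul_le_mul_of_nonneg_left ?_ K.2))
  refine norm_prod_le_iff.2 ⟨(pi_norm_le_iff_of_nonneg he).2 h1,
    norm_prod_le_iff.2 ⟨(pi_norm_le_iff_of_nonneg he).2 h2, ?_⟩⟩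
  change ‖∑ a, y a‖ ≤ e
  rw [h3]; simpa using he

end Flow

end MDP

/-! ### Typical runs -/

namespace MDP

section Path

variable {S A : Type*} (M : MDP S A) (σ : M.Strategy)

lemma exists_extend_of_step_pos {h h' : Loc S A} (hpos : 0 < M.step σ h h') :
    ∃ a s, a ∈ M.Act h.last ∧ h' = h.extend a s := by
  have hmem : h' ∈ (M.step σ h).support := (PMF.mem_support_iff _ _).2 hpos.ne'
  simp only [step, PMF.mem_support_bind_iff, PMF.mem_support_map_iff] at hmem
  obtain ⟨a, ha, s, -, rfl⟩ := hmem
  exact ⟨a, s, σ.enabled h a ha, rfl⟩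

lemma exists_actions_of_mem_runs {ω : ℕ → Loc S A} (hω : ω ∈ M.Runs σ) :
    ∃ act : ℕ → A, ∀ t, M.src (act t) = (ω t).last ∧
      ω (t + 1) = (ω t).extend (act t) (ω (t + 1)).last := by
  have h : ∀ t, ∃ a, M.src a = (ω t).last ∧ ω (t + 1) = (ω t).extend a (ω (t + 1)).last := by
    intro t
    obtain ⟨a, s, ha, hs⟩ := M.exists_extend_of_step_pos σ (hω.2 t)
    exact ⟨a, M.mem_act_iff.1 ha, by rw [hs]; rfl⟩
  exact ⟨fun t => (h t).choose, fun t => (h t).choose_spec⟩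

/-- Lets a strategy read the time off the history. -/
lemma length_past_of_mem_runs {ω : ℕ → Loc S A} (hω : ω ∈ M.Runs σ) (t : ℕ) :
    (ω t).past.length = t := by
  induction t with
  | zero => rw [hω.1]; rfl
  | succ t ih =>
    obtain ⟨a, s, -, hs⟩ := M.exists_extend_of_step_pos σ (hω.2 t)
    rw [hs]; simp [Loc.extend, ih]

open Classical in
/-- The deviation of the successor state from the transition probability to `s`. -/
noncomputable def stateNoise (s : S) (_ h' : Loc S A) : ℝ :=
  -- The last entry of the past carries the action just taken. The default is never met after a
  -- step, and 0 keeps the bound by 1 valid everywhere.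
  h'.past.getLast?.elim 0 fun p => (if h'.last = s then 1 else 0) - (M.δ p.2 s).toReal

variable {M} in
open Classical in
/-- The deviation of the chosen action from the probability of choosing `a`. -/
noncomputable def actNoise (σ : M.Strategy) (a : A) (h h' : Loc S A) : ℝ :=
  h'.past.getLast?.elim 0 fun p => (if p.2 = a then 1 else 0) - (σ.choice h a).toReal

open Classical in
lemma stateNoise_extend (s : S) (h : Loc S A) (a : A) (s' : S) :
    M.stateNoise s h (h.extend a s') = (if s' = s then 1 else 0) - (M.δ a s).toReal := by
  simp [stateNoise, Loc.extend]
  rfl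

open Classical in
lemma actNoise_extend (a : A) (h : Loc S A) (b : A) (s' : S) :
    actNoise σ a h (h.extend b s') = (if b = a then 1 else 0) - (σ.choice h a).toReal := by
  simp [actNoise, Loc.extend]

lemma abs_ite_sub_le_one (p : Prop) [Decidable p] {x : ℝ} (h0 : 0 ≤ x) (h1 : x ≤ 1) :
    |(if p then 1 else 0) - x| ≤ 1 := by
  rw [abs_le]; split_ifs <;> constructor <;> linarith

lemma abs_stateNoise_le (s : S) (h h' : Loc S A) : |M.stateNoise s h h'| ≤ 1 := by
  classical
  unfold stateNoise
  cases h'.past.getLast? with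
  | none => simp
  | some p => exact abs_ite_sub_le_one _ ENNReal.toReal_nonneg (PMF.toReal_apply_le_one _ _)

lemma abs_actNoise_le (a : A) (h h' : Loc S A) : |actNoise σ a h h'| ≤ 1 := by
  classical
  unfold actNoise
  cases h'.past.getLast? with
  | none => simp
  | some p => exact abs_ite_sub_le_one _ ENNReal.toReal_nonneg (PMF.toReal_apply_le_one _ _)

variable [Fintype S] [Fintype A]

lemma integral_stateNoise (s : S) (h : Loc S A) :
    ∫ h', M.stateNoise s h h' ∂(M.step σ h).toMeasure = 0 := by
  classical
  rw [integral_step]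
  refine Finset.sum_eq_zero fun a _ => ?_
  simp_rw [stateNoise_extend, mul_sub, Finset.sum_sub_distrib, ← Finset.sum_mul,
    PMF.sum_toReal_apply]
  simp

lemma integral_actNoise (a : A) (h : Loc S A) :
    ∫ h', actNoise σ a h h' ∂(M.step σ h).toMeasure = 0 := by
  classical
  rw [integral_step]
  simp_rw [actNoise_extend, ← Finset.sum_mul, PMF.sum_toReal_apply, one_mul, mul_sub,
    Finset.sum_sub_distrib, ← Finset.sum_mul, PMF.sum_toReal_apply]
  simp

/-- A state–action sequence with the deviations of its state and action counts from the conditional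
probabilities bounded by `B * T ^ (7/8)`. -/
structure IsTypical (ω : ℕ → Loc S A) (act : ℕ → A) (B : ℝ) : Prop where
  src_act : ∀ t, M.src (act t) = (ω t).last
  length_past : ∀ t, (ω t).past.length = t
  state_le : ∀ T s, |∑ t ∈ Finset.range T,
    ((open Classical in if (ω (t + 1)).last = s then 1 else 0) - (M.δ (act t) s).toReal)| ≤
      B * (T : ℝ) ^ (7 / 8 : ℝ)
  act_le : ∀ T a, |∑ t ∈ Finset.range T, ((open Classical in if act t = a then 1 else 0)
    - (σ.choice (ω t) a).toReal)| ≤ B * (T : ℝ) ^ (7 / 8 : ℝ)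

/-- There are finitely many noises, each almost surely O(T^(7/8)); the sum of their constants serves
for all of them. -/
lemma ae_isTypical :
    ∀ᵐ ω ∂(M.prob σ), ω ∈ M.Runs σ ∧ ∃ act B, 0 ≤ B ∧ M.IsTypical σ ω act B := by
  classical
  have hs := ae_all_iff.2 fun s => M.ae_noise_le σ (M.abs_stateNoise_le s)
    (M.integral_stateNoise σ s)
  have ha := ae_all_iff.2 fun a => M.ae_noise_le σ (M.abs_actNoise_le σ a)
    (M.integral_actNoise σ a)
  filter_upwards [M.ae_mem_runs σ, hs, ha] with ω hω hs ha
  choose Bs hBs0 hBs using hs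
  choose Ba hBa0 hBa using ha
  obtain ⟨act, hact⟩ := M.exists_actions_of_mem_runs σ hω
  have h0s : 0 ≤ ∑ s, Bs s := Finset.sum_nonneg fun s _ => hBs0 s
  have h0a : 0 ≤ ∑ a, Ba a := Finset.sum_nonneg fun a _ => hBa0 a
  refine ⟨hω, act, ∑ s, Bs s + ∑ a, Ba a, by positivity, fun t => (hact t).1,
    M.length_past_of_mem_runs σ hω, fun T s => ?_, fun T a => ?_⟩
  · have h1 : noise (M.stateNoise s) T ω = ∑ t ∈ Finset.range T,
        ((if (ω (t + 1)).last = s then 1 else 0) - (M.δ (act t) s).toReal) :=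
      Finset.sum_congr rfl fun t _ => by rw [(hact t).2, stateNoise_extend]; rfl
    rw [← h1]
    refine (hBs s T).trans (mul_le_mul_of_nonneg_right ?_ (by positivity))
    have := Finset.single_le_sum (fun s _ => hBs0 s) (Finset.mem_univ s)
    linarith
  · have h1 : noise (actNoise σ a) T ω = ∑ t ∈ Finset.range T,
        ((if act t = a then 1 else 0) - (σ.choice (ω t) a).toReal) :=
      Finset.sum_congr rfl fun t _ => by rw [(hact t).2, actNoise_extend]
    rw [← h1]
    refine (hBa a T).trans (mul_le_mul_of_nonneg_right ?_ (by positivity))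
    have := Finset.single_le_sum (fun s _ => hBa0 s) (Finset.mem_univ a)
    linarith

end Path

/-! ### Action counts -/

section Count

variable {S A : Type*} (M : MDP S A) (act : ℕ → A)

open Classical in
/-- The number of times before `T` at which the action is `a`. -/
noncomputable def count (T : ℕ) (a : A) : ℝ := ∑ t ∈ Finset.range T, if act t = a then 1 else 0

lemma count_nonneg (T : ℕ) (a : A) : 0 ≤ count act T a :=
  Finset.sum_nonneg fun t _ => by split_ifs <;> norm_num

open Classical in
lemma mass_count (T : ℕ) (s : S) :
    M.mass (count act T) s = ∑ t ∈ Finset.range T, if M.src (act t) = s then 1 else 0 := by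
  unfold mass count
  rw [Finset.sum_comm]
  refine Finset.sum_congr rfl fun t _ => ?_
  simp [M.mem_act_iff]

variable [Fintype A]

lemma sum_count_mul (T : ℕ) (g : A → ℝ) :
    ∑ a, count act T a * g a = ∑ t ∈ Finset.range T, g (act t) := by
  classical
  unfold count
  simp_rw [Finset.sum_mul]
  rw [Finset.sum_comm]
  simp

lemma sum_count (T : ℕ) : ∑ a, count act T a = T := by
  simpa using sum_count_mul act T fun _ => 1

lemma count_le (T : ℕ) (a : A) : count act T a ≤ T := by
  rw [← sum_count act T]
  exact Finset.single_le_sum (fun a _ => count_nonneg act T a) (Finset.mem_univ a)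

variable {M act} {σ : M.Strategy} {ω : ℕ → Loc S A} {B : ℝ}

/-- Between two times, the action counts of a typical run almost satisfy the Kirchhoff equations. -/
lemma IsTypical.kirchhoff_defect_le (h : M.IsTypical σ ω act B) (hB : 0 ≤ B) {T₀ T : ℕ}
    (hT : T₀ ≤ T) (s : S) :
    |∑ a, (count act T a - count act T₀ a) * (M.δ a s).toReal
      - (M.mass (count act T) s - M.mass (count act T₀) s)| ≤
      1 + 2 * B * (T : ℝ) ^ (7 / 8 : ℝ) := by
  classical
  -- Departures from `s` equal arrivals in `s` up to the two end points. Between `T₀` and `T` these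
  -- boundary terms contribute at most 1, and the two state noises give the factor 2.
  have htel : ∀ T, M.mass (count act T) s = ∑ t ∈ Finset.range T,
      (if (ω (t + 1)).last = s then 1 else 0) + (if (ω 0).last = s then 1 else 0)
        - (if (ω T).last = s then 1 else 0) := fun T => by
    rw [mass_count, ← Finset.sum_range_succ' (fun t => if (ω t).last = s then (1 : ℝ) else 0),
      Finset.sum_range_succ, add_sub_cancel_right]
    simp_rw [h.src_act]
  have h1 := h.state_le T s
  have h0 := h.state_le T₀ s
  have hmono : B * (T₀ : ℝ) ^ (7 / 8 : ℝ) ≤ B * (T : ℝ) ^ (7 / 8 : ℝ) :=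
    mul_le_mul_of_nonneg_left (Real.rpow_le_rpow (by positivity) (by exact_mod_cast hT)
      (by norm_num)) hB
  simp_rw [sub_mul, Finset.sum_sub_distrib, sum_count_mul]
  rw [Finset.sum_sub_distrib] at h1 h0
  rw [htel T, htel T₀]
  have h2 := abs_le.1 h1
  have h3 := abs_le.1 h0
  rw [abs_le]
  constructor <;> split_ifs <;> linarith

end Count

end MDP

/-- Handles strict and weak constraints alike: limits are compared with exact payoffs of flows, and
only these with the thresholds. -/
lemma Cmp.Holds.mono {c : Cmp} {x y p : ℝ} (h : c.Holds x p) (hxy : x ≤ y) : c.Holds y p := by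
  cases c
  · exact le_trans (α := ℝ) h hxy
  · exact lt_of_lt_of_le (α := ℝ) h hxy

/-! ### Long-run averages -/

section Average

variable {f : ℕ → ℝ} {c : ℝ}

lemma abs_average_le (hf : ∀ t, |f t| ≤ c) (T : ℕ) :
    |(∑ j ∈ Finset.range T, f j) / (T : ℝ)| ≤ c := by
  have hc : 0 ≤ c := (abs_nonneg _).trans (hf 0)
  rw [abs_div, Nat.abs_cast]
  refine div_le_of_le_mul₀ (by positivity) hc ?_
  refine (Finset.abs_sum_le_sum_abs _ _).trans ((Finset.sum_le_sum fun t _ => hf t).trans ?_)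
  simp [mul_comm]

lemma isBoundedUnder_le_average (hf : ∀ t, |f t| ≤ c) :
    IsBoundedUnder (· ≤ ·) atTop fun i : ℕ => (∑ j ∈ Finset.range i, f j) / (i : ℝ) :=
  isBoundedUnder_of ⟨c, fun T => (abs_le.1 (abs_average_le hf T)).2⟩

lemma isBoundedUnder_ge_average (hf : ∀ t, |f t| ≤ c) :
    IsBoundedUnder (· ≥ ·) atTop fun i : ℕ => (∑ j ∈ Finset.range i, f j) / (i : ℝ) :=
  isBoundedUnder_of ⟨-c, fun T => (abs_le.1 (abs_average_le hf T)).1⟩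

lemma lrInf_le_of_tendsto (hf : ∀ t, |f t| ≤ c) {φ : ℕ → ℕ} (hφ : Tendsto φ atTop atTop) {l : ℝ}
    (h : Tendsto (fun p => (∑ j ∈ Finset.range (φ p), f j) / (φ p : ℝ)) atTop (𝓝 l)) :
    lrInf f ≤ l :=
  (MapClusterPt.of_comp hφ h.mapClusterPt).liminf_le (isBoundedUnder_ge_average hf)

lemma le_lrSup_of_tendsto (hf : ∀ t, |f t| ≤ c) {φ : ℕ → ℕ} (hφ : Tendsto φ atTop atTop) {l : ℝ}
    (h : Tendsto (fun p => (∑ j ∈ Finset.range (φ p), f j) / (φ p : ℝ)) atTop (𝓝 l)) :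
    l ≤ lrSup f :=
  (MapClusterPt.of_comp hφ h.mapClusterPt).le_limsup (isBoundedUnder_le_average hf)

lemma exists_tendsto_lrSup (hf : ∀ t, |f t| ≤ c) :
    ∃ φ : ℕ → ℕ, Tendsto φ atTop atTop ∧
      Tendsto (fun p => (∑ j ∈ Finset.range (φ p), f j) / (φ p : ℝ)) atTop (𝓝 (lrSup f)) := by
  obtain ⟨φ, h1, h2⟩ := exists_seq_tendsto_limsup
    (hc := (isBoundedUnder_ge_average hf).isCoboundedUnder_le) (hb := isBoundedUnder_le_average hf)
  exact ⟨φ, h2, h1⟩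

/-- A sequence that is close in the mean to one with limit inferior at least `l`. -/
lemma le_lrInf_of_average_le (hf : ∀ t, |f t| ≤ c) {g : ℕ → ℝ} {l : ℝ} (hg : Tendsto g atTop (𝓝 l))
    {d : ℕ → ℝ} (hd : Tendsto d atTop (𝓝 0))
    (hle : ∀ᶠ T : ℕ in atTop,
      (∑ j ∈ Finset.range T, g j) / (T : ℝ) - d T ≤ (∑ j ∈ Finset.range T, f j) / (T : ℝ)) :
    l ≤ lrInf f := by
  have hlim : Tendsto (fun T : ℕ => (∑ j ∈ Finset.range T, g j) / (T : ℝ) - d T) atTop (𝓝 l) := by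
    have := hg.cesaro.sub hd
    simpa [div_eq_inv_mul] using this
  rw [← hlim.liminf_eq]
  exact liminf_le_liminf hle hlim.isBoundedUnder_ge
    (isBoundedUnder_le_average hf).isCoboundedUnder_ge

end Average

/-- As 1/16 + 7/8 < 1, stability constants up to T^(1/16) can be afforded. -/
lemma tendsto_rpow_mul_one_add_div (B : ℝ) :
    Tendsto (fun T : ℕ => (T : ℝ) ^ (1 / 16 : ℝ) * (1 + 2 * B * (T : ℝ) ^ (7 / 8 : ℝ)) / (T : ℝ))
      atTop (𝓝 0) := by
  have h1 : Tendsto (fun T : ℕ => (T : ℝ) ^ (-(15 / 16) : ℝ) + 2 * B * (T : ℝ) ^ (-(1 / 16) : ℝ))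
      atTop (𝓝 (0 + 2 * B * 0)) :=
    ((tendsto_rpow_neg_atTop (by norm_num)).comp tendsto_natCast_atTop_atTop).add
      (((tendsto_rpow_neg_atTop (by norm_num)).comp tendsto_natCast_atTop_atTop).const_mul _)
  rw [mul_zero, add_zero] at h1
  refine h1.congr' ?_
  filter_upwards [eventually_gt_atTop 0] with T hT
  have hT' : (0 : ℝ) < T := by exact_mod_cast hT
  rw [mul_add, mul_one, add_div, mul_left_comm, ← Real.rpow_add hT', mul_div_assoc,
    ← Real.rpow_sub_one hT'.ne', ← Real.rpow_sub_one hT'.ne']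
  norm_num

lemma tendsto_one_add_rpow_div (B : ℝ) :
    Tendsto (fun T : ℕ => (1 + 2 * B * (T : ℝ) ^ (7 / 8 : ℝ)) / (T : ℝ)) atTop (𝓝 0) := by
  have h1 : Tendsto (fun T : ℕ => (T : ℝ)⁻¹ + 2 * B * (T : ℝ) ^ (-(1 / 8) : ℝ))
      atTop (𝓝 (0 + 2 * B * 0)) :=
    (tendsto_inv_atTop_nhds_zero_nat (𝕜 := ℝ)).add
      (((tendsto_rpow_neg_atTop (by norm_num)).comp tendsto_natCast_atTop_atTop).const_mul _)
  rw [mul_zero, add_zero] at h1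
  refine h1.congr' ?_
  filter_upwards [eventually_gt_atTop 0] with T hT
  have hT' : (0 : ℝ) < T := by exact_mod_cast hT
  rw [add_div, mul_div_assoc, ← Real.rpow_sub_one hT'.ne', one_div]
  norm_num

/-! ### From runs to flows -/

namespace MDP

lemma exists_abs_reward_le {S : Type*} [Fintype S] (r : S → ℝ) : ∃ c, ∀ s, |r s| ≤ c :=
  ⟨∑ s, |r s|, fun s => Finset.single_le_sum (f := fun s => |r s|) (fun _ _ => abs_nonneg _)
    (Finset.mem_univ s)⟩

variable {S A : Type*} [Fintype A] {M : MDP S A} {σ : M.Strategy} {ω : ℕ → Loc S A}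
  {act : ℕ → A} {B : ℝ}

lemma IsTypical.sum_count_mul_reward (h : M.IsTypical σ ω act B) (T : ℕ) (r : S → ℝ) :
    ∑ a, count act T a * r (M.src a) = ∑ t ∈ Finset.range T, r (ω t).last := by
  rw [sum_count_mul act T fun a => r (M.src a)]
  simp_rw [h.src_act]

/-- Limit points of the action frequencies of a typical run are flows. -/
lemma IsTypical.isFlow_of_tendsto (h : M.IsTypical σ ω act B) (hB : 0 ≤ B) {φ : ℕ → ℕ}
    (hφ : Tendsto φ atTop atTop) {x : A → ℝ}
    (hx : Tendsto (fun p a => count act (φ p) a / (φ p : ℝ)) atTop (𝓝 x)) : M.IsFlow x := by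
  have hxa : ∀ a, Tendsto (fun p => count act (φ p) a / (φ p : ℝ)) atTop (𝓝 (x a)) :=
    tendsto_pi_nhds.1 hx
  refine ⟨fun a => ?_, ?_, fun s => ?_⟩
  · exact ge_of_tendsto' (hxa a) fun p => div_nonneg (count_nonneg _ _ _) (by positivity)
  · refine tendsto_nhds_unique (tendsto_finsetSum _ fun a _ => hxa a) ?_
    refine tendsto_const_nhds.congr' ?_
    filter_upwards [hφ.eventually_gt_atTop 0] with p hp
    have hp' : (φ p : ℝ) ≠ 0 := by exact_mod_cast hp.ne'
    rw [← Finset.sum_div, sum_count, div_self hp']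
  · have h1 : Tendsto (fun p => ∑ a, count act (φ p) a / (φ p : ℝ) * (M.δ a s).toReal
        - ∑ a ∈ M.Act s, count act (φ p) a / (φ p : ℝ)) atTop
        (𝓝 (∑ a, x a * (M.δ a s).toReal - M.mass x s)) :=
      (tendsto_finsetSum _ fun a _ => (hxa a).mul_const _).sub
        (tendsto_finsetSum _ fun a _ => hxa a)
    have h2 := (tendsto_one_add_rpow_div B).comp hφ
    refine sub_eq_zero.1 (tendsto_nhds_unique h1 (squeeze_zero_norm (fun p => ?_) h2))
    have h3 := h.kirchhoff_defect_le hB (Nat.zero_le (φ p)) s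
    have h4 : ∀ a, count act 0 a = 0 := fun a => by simp [count]
    have h5 : M.mass (count act 0) s = 0 := Finset.sum_eq_zero fun a _ => h4 a
    simp only [h4, h5, sub_zero] at h3
    simp_rw [div_mul_eq_mul_div]
    rw [← Finset.sum_div, ← Finset.sum_div, ← sub_div, norm_div, Real.norm_natCast]
    exact div_le_div_of_nonneg_right h3 (by positivity)

/-- Frequencies lie in the compact cube, so they converge along a subsequence of times realising the
limit superior of `q`. The same limit `x` then serves every `r`, a limit inferior being below any
subsequential limit. -/
lemma IsTypical.exists_flow [Fintype S] (h : M.IsTypical σ ω act B) (hB : 0 ≤ B) (q : S → ℝ) :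
    ∃ x, M.IsFlow x ∧ ∑ a, x a * q (M.src a) = lrSup (fun t => q (ω t).last) ∧
      ∀ r : S → ℝ, lrInf (fun t => r (ω t).last) ≤ ∑ a, x a * r (M.src a) := by
  obtain ⟨c, hc⟩ := exists_abs_reward_le q
  obtain ⟨φ, hφ, hφq⟩ := exists_tendsto_lrSup (f := fun t => q (ω t).last) fun t => hc _
  obtain ⟨x, -, ψ, hψ, hx⟩ := (isCompact_Icc (a := (0 : A → ℝ)) (b := 1)).tendsto_subseq
    (x := fun p a => count act (φ p) a / (φ p : ℝ)) fun p =>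
      ⟨fun a => div_nonneg (count_nonneg _ _ _) (by positivity),
        fun a => div_le_one_of_le₀ (count_le _ _ _) (by positivity)⟩
  have hφψ := hφ.comp hψ.tendsto_atTop
  have hr : ∀ r : S → ℝ, Tendsto (fun p => (∑ t ∈ Finset.range (φ (ψ p)), r (ω t).last) /
      (φ (ψ p) : ℝ)) atTop (𝓝 (∑ a, x a * r (M.src a))) := fun r => by
    have h1 : Tendsto (fun p => ∑ a, count act (φ (ψ p)) a / (φ (ψ p) : ℝ) * r (M.src a)) atTop
        (𝓝 (∑ a, x a * r (M.src a))) :=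
      tendsto_finsetSum _ fun a _ => (tendsto_pi_nhds.1 hx a).mul_const _
    refine h1.congr fun p => ?_
    simp_rw [div_mul_eq_mul_div]
    rw [← Finset.sum_div, h.sum_count_mul_reward]
  refine ⟨x, h.isFlow_of_tendsto hB hφψ hx, ?_, fun r => ?_⟩
  · exact tendsto_nhds_unique (hr q) (hφq.comp hψ.tendsto_atTop)
  · obtain ⟨c, hc⟩ := exists_abs_reward_le r
    exact lrInf_le_of_tendsto (f := fun t => r (ω t).last) (fun t => hc _) hφψ (hr r)

end MDP

open MDP in
/-- A condition that holds with positive probability yields a solution of the linear system. -/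
lemma AccCond.HoldsOn.exists_isNonnegSolution {S A : Type*} [Fintype S] [Fintype A] {M : MDP S A}
    {k m n : ℕ} {acc : AccCond S k m n} {σ : M.Strategy} {R : Set (ℕ → Loc S A)}
    (hR : acc.HoldsOn M σ R) (hpos : M.prob σ R ≠ 0) :
    ∃ x : Fin n → A → ℝ, acc.IsNonnegSolution M x := by
  obtain ⟨ω, hω, -, act, B, hB, htyp⟩ :=
    ((frequently_ae_mem_iff.2 hpos).and_eventually (M.ae_isTypical σ)).exists
  obtain ⟨-, hinf, hsup⟩ := hR.sat ω hω
  choose x hflow hq hr using fun i => htyp.exists_flow hB (acc.q i)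
  refine ⟨x, fun i => (hflow i).nonneg, fun i => (hflow i).total, fun i => (hflow i).kirchhoff,
    fun i j => ?_, fun i => ?_⟩
  · rw [M.sum_act fun a s => x i a * acc.r j s]
    exact (hinf j).mono (hr i (acc.r j))
  · rw [M.sum_act fun a s => x i a * acc.q i s, hq i]
    exact hsup i

/-! ### Scheduling the phases -/

/-- Sparse times at which a summed sequence of constants is small compared to the time. -/
lemma exists_schedule (D : ℕ → ℝ) :
    ∃ τ : ℕ → ℕ, τ 0 = 0 ∧ StrictMono τ ∧ (∀ l, l * τ l ≤ τ (l + 1)) ∧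
      ∀ l, ∑ i ∈ Finset.range (l + 2), D i ≤ (τ (l + 1) : ℝ) ^ (1 / 16 : ℝ) := by
  let K : ℕ → ℕ := fun l => ⌈∑ i ∈ Finset.range (l + 2), D i⌉₊
  -- The terms provide long phases, the 1/16-th root bound and strict growth. `K l` already includes
  -- the constant of phase `l + 1`, which starts at `τ (l + 1)`.
  let τ : ℕ → ℕ := fun l => Nat.rec 0 (fun l t => (l + 1) * t + K l ^ 16 + 1) l
  have hτ : ∀ l, τ (l + 1) = (l + 1) * τ l + K l ^ 16 + 1 := fun l => rfl
  refine ⟨τ, rfl, strictMono_nat_of_lt_succ fun l => ?_, fun l => ?_, fun l => ?_⟩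
  · rw [hτ]; nlinarith [Nat.zero_le (l * τ l), Nat.zero_le (K l ^ 16)]
  · rw [hτ]; nlinarith [Nat.zero_le (τ l), Nat.zero_le (K l ^ 16)]
  · have h1 : (K l : ℝ) ^ 16 ≤ τ (l + 1) := by
      have h : K l ^ 16 ≤ τ (l + 1) := by
        rw [hτ]; nlinarith [Nat.zero_le ((l + 1) * τ l)]
      exact_mod_cast h
    refine (Nat.le_ceil _).trans ?_
    change (K l : ℝ) ≤ _
    have h2 : (K l : ℝ) = ((K l : ℝ) ^ 16) ^ (1 / 16 : ℝ) := by
      rw [← Real.rpow_natCast, ← Real.rpow_mul (by positivity)]; norm_num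
    rw [h2]
    exact Real.rpow_le_rpow (by positivity) h1 (by norm_num)

/-- The index of the phase to which a time belongs. -/
lemma exists_phase_index {τ : ℕ → ℕ} (h0 : τ 0 = 0) (hτ : StrictMono τ) :
    ∃ idx : ℕ → ℕ, (∀ t, τ (idx t) ≤ t ∧ t < τ (idx t + 1)) ∧
      ∀ l t, τ l ≤ t → t < τ (l + 1) → idx t = l := by
  have hex : ∀ t, ∃ l, τ l ≤ t ∧ t < τ (l + 1) := fun t => by
    refine ⟨Nat.findGreatest (fun l => τ l ≤ t) t,
      Nat.findGreatest_spec (P := fun l => τ l ≤ t) (Nat.zero_le t) (by omega), ?_⟩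
    by_contra! h
    have h1 := Nat.le_findGreatest (P := fun l => τ l ≤ t) ((hτ.le_apply).trans h) h
    omega
  choose idx hidx using hex
  refine ⟨idx, hidx, fun l t h1 h2 => ?_⟩
  have h3 := hτ.lt_iff_lt.1 ((hidx t).1.trans_lt h2)
  have h4 := hτ.lt_iff_lt.1 (h1.trans_lt (hidx t).2)
  omega

/-! ### Playing positive flows -/

namespace MDP

section TimeStrategy

variable {S A : Type*} (M : MDP S A)

open Classical in
/-- The distribution on the actions enabled in `s` that is proportional to `x`. -/
noncomputable def policy (x : A → ℝ) (hx : ∀ a, 0 < x a) (s : S) : PMF A :=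
  PMF.ofFinset (fun a => if a ∈ M.Act s then ENNReal.ofReal (x a / M.mass x s) else 0) (M.Act s)
    (by
      rw [Finset.sum_congr rfl fun a ha => if_pos ha,
        ← ENNReal.ofReal_sum_of_nonneg fun a _ => (div_pos (hx a) (M.mass_pos hx s)).le,
        ← Finset.sum_div]
      change ENNReal.ofReal (M.mass x s / _) = 1
      rw [div_self (M.mass_pos hx s).ne', ENNReal.ofReal_one])
    fun a ha => if_neg ha

open Classical in
lemma policy_apply_toReal (x : A → ℝ) (hx : ∀ a, 0 < x a) (s : S) (a : A) :
    (M.policy x hx s a).toReal = if s = M.src a then x a / M.mass x (M.src a) else 0 := by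
  have hpos : 0 ≤ x a / M.mass x s := (div_pos (hx a) (M.mass_pos hx s)).le
  simp only [policy, PMF.ofFinset_apply, mem_act_iff]
  by_cases h : M.src a = s
  · subst h; simp [ENNReal.toReal_ofReal hpos]
  · simp [h, Ne.symm h]

/-- The strategy that uses at time `t` the probabilities proportional to `z t`. -/
noncomputable def timeStrategy (z : ℕ → A → ℝ) (hz : ∀ t a, 0 < z t a) : M.Strategy where
  choice h := M.policy (z h.past.length) (hz _) h.last
  enabled h a ha := by
    classical
    rw [policy, PMF.mem_support_ofFinset_iff] at ha
    exact ha.1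

variable {M} [Fintype A]

/-- While a fixed positive flow is played, the action counts of a typical run follow it. -/
lemma IsTypical.abs_count_sub_le {z : ℕ → A → ℝ} {hz : ∀ t a, 0 < z t a} {ω : ℕ → Loc S A}
    {act : ℕ → A} {B : ℝ} (h : M.IsTypical (M.timeStrategy z hz) ω act B) (hB : 0 ≤ B)
    {x : A → ℝ} (hx : M.IsFlow x) (hpos : ∀ a, 0 < x a) {C : ℝ}
    (hC : ∀ (y : A → ℝ) (e : ℝ),
      (∀ s, |∑ a, y a * (M.δ a s).toReal - M.mass y s| ≤ e) →
      (∀ a, |y a - x a / M.mass x (M.src a) * M.mass y (M.src a)| ≤ e) → ∑ a, y a = 0 →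
      ∀ a, |y a| ≤ C * e)
    {T₀ T : ℕ} (hT : T₀ ≤ T) (hzx : ∀ t, T₀ ≤ t → t < T → z t = x) (a : A) :
    |count act T a - count act T₀ a - ((T : ℝ) - T₀) * x a| ≤
      C * (1 + 2 * B * (T : ℝ) ^ (7 / 8 : ℝ)) := by
  classical
  -- As `x` is a flow, `y` has total zero and the Kirchhoff defect of the counts. Its policy defect
  -- is a difference of two action noises, so stability applies.
  set y : A → ℝ := fun a => count act T a - count act T₀ a - ((T : ℝ) - T₀) * x a with hy
  have hmass : ∀ s, M.mass y s =
      M.mass (count act T) s - M.mass (count act T₀) s - ((T : ℝ) - T₀) * M.mass x s := fun s => by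
    simp only [mass, hy, Finset.sum_sub_distrib, ← Finset.mul_sum]
  refine hC y _ (fun s => ?_) (fun b => ?_) ?_ a
  · have h1 := h.kirchhoff_defect_le hB hT s
    have h2 := hx.kirchhoff s
    have h3 : ∑ a, y a * (M.δ a s).toReal - M.mass y s =
        ∑ a, (count act T a - count act T₀ a) * (M.δ a s).toReal
          - (M.mass (count act T) s - M.mass (count act T₀) s) := by
      rw [hmass]
      simp only [hy, sub_mul _ (((T : ℝ) - T₀) * _), Finset.sum_sub_distrib, mul_assoc,
        ← Finset.mul_sum, h2]
      ring
    rwa [h3]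
  · have hm := (M.mass_pos hpos (M.src b)).ne'
    have h1 : y b - x b / M.mass x (M.src b) * M.mass y (M.src b) =
        (∑ t ∈ Finset.range T, ((if act t = b then 1 else 0)
          - ((M.timeStrategy z hz).choice (ω t) b).toReal))
        - ∑ t ∈ Finset.range T₀, ((if act t = b then 1 else 0)
          - ((M.timeStrategy z hz).choice (ω t) b).toReal) := by
      have h2 : ∑ t ∈ Finset.Ico T₀ T, ((M.timeStrategy z hz).choice (ω t) b).toReal =
          x b / M.mass x (M.src b) *
            (M.mass (count act T) (M.src b) - M.mass (count act T₀) (M.src b)) := by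
        rw [mass_count, mass_count, ← Finset.sum_Ico_eq_sub _ hT, Finset.mul_sum]
        refine Finset.sum_congr rfl fun t ht => ?_
        obtain ⟨h3, h4⟩ := Finset.mem_Ico.1 ht
        change (M.policy (z (ω t).past.length) (hz _) (ω t).last b).toReal = _
        rw [policy_apply_toReal, h.length_past, hzx t h3 h4, ← h.src_act, mul_ite, mul_one,
          mul_zero]
      rw [Finset.sum_sub_distrib, Finset.sum_sub_distrib, hmass]
      rw [Finset.sum_Ico_eq_sub _ hT] at h2
      have h5 : x b / M.mass x (M.src b) * M.mass x (M.src b) = x b := div_mul_cancel₀ _ hm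
      simp only [hy, count]
      linear_combination h2 + ((T : ℝ) - T₀) * h5
    rw [h1]
    have h6 := abs_le.1 (h.act_le T b)
    have h7 := abs_le.1 (h.act_le T₀ b)
    have hmono : B * (T₀ : ℝ) ^ (7 / 8 : ℝ) ≤ B * (T : ℝ) ^ (7 / 8 : ℝ) :=
      mul_le_mul_of_nonneg_left (Real.rpow_le_rpow (by positivity) (by exact_mod_cast hT)
        (by norm_num)) hB
    rw [abs_le]
    constructor <;> linarith
  · simp only [hy, Finset.sum_sub_distrib, ← Finset.mul_sum, sum_count, hx.total]
    ring

end TimeStrategy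

end MDP

/-! ### Following a sequence of flows -/

namespace MDP

section Phases

variable {S A : Type*}

/-- Action counts of a run during which the flows `z 0, z 1, …` are played in the phases that end at
the times `τ 1, τ 2, …`. -/
lemma abs_count_sub_sum_le {act : ℕ → A} {z : ℕ → A → ℝ} {C : ℕ → ℝ} (hC : ∀ l, 0 ≤ C l)
    {τ idx : ℕ → ℕ} (hτ0 : τ 0 = 0) (hτ : StrictMono τ)
    (hidx : ∀ l t, τ l ≤ t → t < τ (l + 1) → idx t = l) {B : ℝ} (hB : 0 ≤ B)
    (hphase : ∀ l t, τ l ≤ t → t ≤ τ (l + 1) → ∀ a,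
      |count act t a - count act (τ l) a - ((t : ℝ) - τ l) * z l a| ≤
        C l * (1 + 2 * B * (t : ℝ) ^ (7 / 8 : ℝ)))
    (l t : ℕ) (h1 : τ l ≤ t) (h2 : t ≤ τ (l + 1)) (a : A) :
    |count act t a - ∑ s ∈ Finset.range t, z (idx s) a| ≤
      (∑ i ∈ Finset.range (l + 1), C i) * (1 + 2 * B * (t : ℝ) ^ (7 / 8 : ℝ)) := by
  have hsum : ∀ l t, τ l ≤ t → t ≤ τ (l + 1) → ∑ s ∈ Finset.range t, z (idx s) a =
      ∑ s ∈ Finset.range (τ l), z (idx s) a + ((t : ℝ) - τ l) * z l a := fun l t h1 h2 => by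
    rw [← Finset.sum_range_add_sum_Ico _ h1]
    congr 1
    rw [Finset.sum_congr rfl fun s hs => by
      rw [hidx l s (Finset.mem_Ico.1 hs).1 ((Finset.mem_Ico.1 hs).2.trans_le h2)]]
    rw [Finset.sum_const, Nat.card_Ico, nsmul_eq_mul, Nat.cast_sub h1]
  have hstart : |count act (τ l) a - ∑ s ∈ Finset.range (τ l), z (idx s) a| ≤
      (∑ i ∈ Finset.range l, C i) * (1 + 2 * B * (τ l : ℝ) ^ (7 / 8 : ℝ)) := by
    clear h1 h2
    induction l with
    | zero => simp [hτ0, count]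
    | succ l ih =>
      have hlt := (hτ (Nat.lt_succ_self l)).le
      have h3 := hphase l _ hlt le_rfl a
      have hmono : 1 + 2 * B * (τ l : ℝ) ^ (7 / 8 : ℝ) ≤
          1 + 2 * B * (τ (l + 1) : ℝ) ^ (7 / 8 : ℝ) := by
        gcongr
      have h4 := ih.trans (mul_le_mul_of_nonneg_left hmono (Finset.sum_nonneg fun i _ => hC i))
      rw [hsum l _ hlt le_rfl, Finset.sum_range_succ, add_mul]
      rw [abs_le] at h3 h4 ⊢
      constructor <;> linarith
  have h3 := hphase l t h1 h2 a
  have hmono : 1 + 2 * B * (τ l : ℝ) ^ (7 / 8 : ℝ) ≤ 1 + 2 * B * (t : ℝ) ^ (7 / 8 : ℝ) := by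
    gcongr
  have h4 := hstart.trans (mul_le_mul_of_nonneg_left hmono (Finset.sum_nonneg fun i _ => hC i))
  rw [hsum l t h1 h2, Finset.sum_range_succ, add_mul]
  rw [abs_le] at h3 h4 ⊢
  constructor <;> linarith

variable [Fintype A] {M : MDP S A}

/-- A sequence of positive flows can be followed phase by phase, by a strategy that takes every
action infinitely often. -/
lemma StronglyConnected.exists_strategy_following [Fintype S] (hM : M.StronglyConnected)
    {z : ℕ → A → ℝ} (hz : ∀ l, M.IsFlow (z l)) (hpos : ∀ l a, 0 < z l a) :
    ∃ (σ : M.Strategy) (τ idx : ℕ → ℕ), StrictMono τ ∧ (∀ l, l * τ l ≤ τ (l + 1)) ∧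
      (∀ t, t < τ (idx t + 1)) ∧ (∀ l t, τ l ≤ t → t < τ (l + 1) → idx t = l) ∧
      ∀ (ω : ℕ → Loc S A) (act : ℕ → A) (B : ℝ), 0 ≤ B → M.IsTypical σ ω act B →
        (∀ a, Tendsto (fun t : ℕ => (count act t a - ∑ s ∈ Finset.range t, z (idx s) a) / (t : ℝ))
          atTop (𝓝 0)) ∧ ∀ a, ∃ᶠ t in atTop, act t = a := by
  classical
  choose C hC0 hC using fun l => hM.exists_stability_const (hz l) (hpos l)
  -- The first term controls the deviation of the frequencies. The quotients ensure that this
  -- deviation is smaller than the expected count of every single action.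
  let D : ℕ → ℝ := fun l => C l + ∑ a, C l / z l a
  have hCz : ∀ l a, 0 ≤ C l / z l a := fun l a => (div_pos (hC0 l) (hpos l a)).le
  have hCD : ∀ l, C l ≤ D l := fun l =>
    le_add_of_nonneg_right (Finset.sum_nonneg fun a _ => hCz l a)
  have hCzD : ∀ l a, C l / z l a ≤ D l := fun l a =>
    (Finset.single_le_sum (fun a _ => hCz l a) (Finset.mem_univ a)).trans
      (le_add_of_nonneg_left (hC0 l).le)
  have hD0 : ∀ l, 0 ≤ D l := fun l => (hC0 l).le.trans (hCD l)
  obtain ⟨τ, hτ0, hτ, hlong, hτD⟩ := exists_schedule D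
  obtain ⟨idx, hidx, hidx'⟩ := exists_phase_index hτ0 hτ
  refine ⟨M.timeStrategy (fun t => z (idx t)) fun t => hpos _, τ, idx, hτ, hlong,
    fun t => (hidx t).2, hidx', fun ω act B hB h => ?_⟩
  have hphase : ∀ l t, τ l ≤ t → t ≤ τ (l + 1) → ∀ a,
      |count act t a - count act (τ l) a - ((t : ℝ) - τ l) * z l a| ≤
        C l * (1 + 2 * B * (t : ℝ) ^ (7 / 8 : ℝ)) := fun l t h1 h2 a =>
    h.abs_count_sub_le hB (hz l) (hpos l) (hC l) h1
      (fun s hs1 hs2 => by rw [hidx' l s hs1 (hs2.trans_le h2)]) a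
  have hidxpos : ∀ᶠ t in atTop, 1 ≤ idx t := by
    filter_upwards [eventually_ge_atTop (τ 1)] with t ht
    have := hτ.lt_iff_lt.1 (ht.trans_lt (hidx t).2)
    omega
  refine ⟨fun a => ?_, fun a => ?_⟩
  · refine squeeze_zero_norm' ?_ (tendsto_rpow_mul_one_add_div B)
    filter_upwards [hidxpos] with t ht
    rw [norm_div, Real.norm_natCast, Real.norm_eq_abs]
    refine div_le_div_of_nonneg_right ?_ (by positivity)
    refine (abs_count_sub_sum_le (fun l => (hC0 l).le) hτ0 hτ hidx' hB hphase (idx t) t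
      (hidx t).1 (hidx t).2.le a).trans (mul_le_mul_of_nonneg_right ?_ (by positivity))
    obtain ⟨l, hl⟩ : ∃ l, idx t = l + 1 := ⟨idx t - 1, by omega⟩
    rw [hl]
    refine (Finset.sum_le_sum fun i _ => hCD i).trans ((hτD l).trans ?_)
    refine Real.rpow_le_rpow (by positivity) ?_ (by norm_num)
    rw [← hl]; exact_mod_cast (hidx t).1
  · have hlim := (tendsto_rpow_mul_one_add_div B).comp
      (hτ.tendsto_atTop.comp (tendsto_add_atTop_nat 1))
    have hsmall := hlim.eventually_lt_const (show (0 : ℝ) < 1 / 2 by norm_num)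
    -- For `l ≥ 2`, phase `l` fills at least half of the time up to its end. In late phases the
    -- expected count of `a` then exceeds the possible deviation, so `a` occurs.
    refine frequently_atTop.2 fun N => ?_
    obtain ⟨l, hl1, hl2, hlN⟩ :=
      (hsmall.and ((eventually_ge_atTop 2).and (eventually_ge_atTop N))).exists
    simp only [Function.comp_apply] at hl1
    have hlt := (hτ (Nat.lt_succ_self l)).le
    have hτpos : (0 : ℝ) < τ (l + 1) := by
      exact_mod_cast (Nat.zero_le _).trans_lt (hτ (Nat.lt_succ_self l))
    have hhalf : (τ (l + 1) : ℝ) / 2 ≤ (τ (l + 1) : ℝ) - τ l := by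
      have h1 : 2 * τ l ≤ τ (l + 1) := (Nat.mul_le_mul_right _ hl2).trans (hlong l)
      have h2 : (2 : ℝ) * τ l ≤ τ (l + 1) := by exact_mod_cast h1
      linarith
    have hDl : C l / z l a ≤ (τ (l + 1) : ℝ) ^ (1 / 16 : ℝ) := by
      refine (hCzD l a).trans (le_trans ?_ (hτD l))
      exact Finset.single_le_sum (fun i _ => hD0 i) (Finset.mem_range.2 (by omega))
    have hgap : C l * (1 + 2 * B * (τ (l + 1) : ℝ) ^ (7 / 8 : ℝ)) <
        ((τ (l + 1) : ℝ) - τ l) * z l a := by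
      rw [div_lt_iff₀ hτpos] at hl1
      have h1 : C l / z l a * (1 + 2 * B * (τ (l + 1) : ℝ) ^ (7 / 8 : ℝ)) <
          (τ (l + 1) : ℝ) - τ l :=
        (mul_le_mul_of_nonneg_right hDl (by positivity)).trans_lt (hl1.trans_le (by linarith))
      have h2 := mul_lt_mul_of_pos_right h1 (hpos l a)
      have h3 : C l / z l a * z l a = C l := div_mul_cancel₀ _ (hpos l a).ne'
      calc _ = C l / z l a * z l a * (1 + 2 * B * (τ (l + 1) : ℝ) ^ (7 / 8 : ℝ)) := by rw [h3]
        _ < _ := by linarith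
    have hcount : 0 < count act (τ (l + 1)) a - count act (τ l) a := by
      have := (abs_le.1 (hphase l _ hlt le_rfl a)).1
      linarith
    unfold count at hcount
    rw [← Finset.sum_Ico_eq_sub _ hlt] at hcount
    obtain ⟨t, ht, hta⟩ := Finset.exists_ne_zero_of_sum_ne_zero hcount.ne'
    refine ⟨t, hlN.trans (hτ.le_apply.trans (Finset.mem_Ico.1 ht).1), ?_⟩
    by_contra hne
    exact hta (if_neg hne)

end Phases

end MDP

/-- The reward sums of a sequence that is constant on phases, at the end of a phase. -/
lemma abs_sum_sub_mul_le {ρ w : ℕ → ℝ} {c : ℝ} {τ : ℕ → ℕ} (hτ : StrictMono τ)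
    (hlong : ∀ l, l * τ l ≤ τ (l + 1)) (hρ : ∀ t, |ρ t| ≤ c)
    (hw : ∀ l t, τ l ≤ t → t < τ (l + 1) → ρ t = w l) {l : ℕ} (hl : 0 < l) :
    |(∑ t ∈ Finset.range (τ (l + 1)), ρ t) / (τ (l + 1) : ℝ) - w l| ≤ 2 * c / l := by
  have hc : 0 ≤ c := (abs_nonneg _).trans (hρ 0)
  have hlt := hτ (Nat.lt_succ_self l)
  have hpos : (0 : ℝ) < τ (l + 1) := by exact_mod_cast (Nat.zero_le _).trans_lt hlt
  have hl' : (0 : ℝ) < l := by exact_mod_cast hl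
  have h1 : ∑ t ∈ Finset.range (τ (l + 1)), ρ t =
      ∑ t ∈ Finset.range (τ l), ρ t + ((τ (l + 1) : ℝ) - τ l) * w l := by
    rw [← Finset.sum_range_add_sum_Ico _ hlt.le]
    congr 1
    rw [Finset.sum_congr rfl fun s hs =>
      hw l s (Finset.mem_Ico.1 hs).1 (Finset.mem_Ico.1 hs).2]
    rw [Finset.sum_const, Nat.card_Ico, nsmul_eq_mul, Nat.cast_sub hlt.le]
  have h2 : |∑ t ∈ Finset.range (τ l), ρ t| ≤ τ l * c := by
    refine (Finset.abs_sum_le_sum_abs _ _).trans ((Finset.sum_le_sum fun t _ => hρ t).trans ?_)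
    simp
  have h3 : |w l| ≤ c := by rw [← hw l (τ l) le_rfl hlt]; exact hρ _
  have h4 : (l : ℝ) * τ l ≤ τ (l + 1) := by exact_mod_cast hlong l
  have h5 : (∑ t ∈ Finset.range (τ (l + 1)), ρ t) / (τ (l + 1) : ℝ) - w l =
      (∑ t ∈ Finset.range (τ l), ρ t - τ l * w l) / (τ (l + 1) : ℝ) := by
    rw [h1]; field_simp; ring
  rw [h5, abs_div, Nat.abs_cast, div_le_div_iff₀ hpos hl']
  -- Only the time before phase `l` contributes, which is at most a fraction 1/l; there `ρ` and `w
  -- l` are both bounded by `c`.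
  have h6 : |∑ t ∈ Finset.range (τ l), ρ t - τ l * w l| ≤ 2 * c * τ l := by
    refine (abs_sub _ _).trans ?_
    rw [abs_mul, Nat.abs_cast]
    have := mul_le_mul_of_nonneg_left h3 (Nat.cast_nonneg (α := ℝ) (τ l))
    linarith
  calc _ ≤ 2 * c * τ l * l := mul_le_mul_of_nonneg_right h6 hl'.le
    _ = 2 * c * (l * τ l) := by ring
    _ ≤ _ := mul_le_mul_of_nonneg_left h4 (by positivity)

/-- Removing a measurable null set that covers the failures spares a proof that the acceptance
condition is measurable. -/
lemma MeasureTheory.exists_measurableSet_subset_of_ae {α : Type*} [MeasurableSpace α]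
    {μ : Measure α} [IsProbabilityMeasure μ] {p : α → Prop} (h : ∀ᵐ x ∂μ, p x) :
    ∃ R : Set α, MeasurableSet R ∧ μ R = 1 ∧ ∀ x ∈ R, p x := by
  obtain ⟨t, ht1, ht2, ht3⟩ := exists_measurable_superset_of_null (ae_iff.1 h)
  refine ⟨tᶜ, ht2.compl, (prob_compl_eq_one_iff ht2).2 ht3, fun x hx => ?_⟩
  by_contra hp
  exact hx (ht1 hp)

namespace MDP

variable {S A : Type*} [Fintype A] {M : MDP S A}

lemma IsFlow.abs_sum_mul_le {x : A → ℝ} (hx : M.IsFlow x) {r : S → ℝ} {c : ℝ}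
    (hr : ∀ s, |r s| ≤ c) : |∑ a, x a * r (M.src a)| ≤ c := by
  calc |∑ a, x a * r (M.src a)| ≤ ∑ a, |x a * r (M.src a)| := Finset.abs_sum_le_sum_abs _ _
    _ ≤ ∑ a, x a * c := Finset.sum_le_sum fun a _ => by
        rw [abs_mul, abs_of_nonneg (hx.nonneg a)]
        exact mul_le_mul_of_nonneg_left (hr _) (hx.nonneg a)
    _ = c := by rw [← Finset.sum_mul, hx.total, one_mul]

/-- If the action counts of a run follow a sequence of weights, so do its mean payoffs. -/
lemma IsTypical.tendsto_average_sub {σ : M.Strategy} {ω : ℕ → Loc S A} {act : ℕ → A} {B : ℝ}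
    (h : M.IsTypical σ ω act B) {y : ℕ → A → ℝ}
    (hy : ∀ a, Tendsto (fun t : ℕ => (count act t a - ∑ s ∈ Finset.range t, y s a) / (t : ℝ))
      atTop (𝓝 0)) (r : S → ℝ) :
    Tendsto (fun T : ℕ => (∑ t ∈ Finset.range T, r (ω t).last) / (T : ℝ)
      - (∑ t ∈ Finset.range T, ∑ a, y t a * r (M.src a)) / (T : ℝ)) atTop (𝓝 0) := by
  have h1 : Tendsto (fun T : ℕ => ∑ a, (count act T a - ∑ s ∈ Finset.range T, y s a) / (T : ℝ)
      * r (M.src a)) atTop (𝓝 (∑ a, 0 * r (M.src a))) :=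
    tendsto_finsetSum _ fun a _ => (hy a).mul_const _
  simp only [zero_mul, Finset.sum_const_zero] at h1
  refine h1.congr fun T => ?_
  simp_rw [div_mul_eq_mul_div]
  rw [← Finset.sum_div, ← sub_div, ← h.sum_count_mul_reward, Finset.sum_comm]
  simp_rw [← Finset.sum_mul, sub_mul, Finset.sum_sub_distrib]

end MDP

/-! ### From solutions to strategies -/

open MDP in
/-- A solution of the linear system yields a strategy under which the condition holds almost
surely. -/
lemma AccCond.IsNonnegSolution.exists_strategy {S A : Type*} [Fintype S] [Fintype A] {M : MDP S A}
    (hM : M.StronglyConnected) {k m n : ℕ} {acc : AccCond S k m n}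
    (hbuchi : ∀ i, (acc.buchi i).Nonempty) (hn : n = 0 → m = 0) {x : Fin n → A → ℝ}
    (hx : acc.IsNonnegSolution M x) :
    ∃ (σ : M.Strategy) (R : Set (ℕ → Loc S A)), acc.HoldsOn M σ R ∧ M.prob σ R = 1 := by
  obtain ⟨y, hy, hypos⟩ := hM.exists_pos_flow
  have hflow : ∀ i, M.IsFlow (x i) := fun i => ⟨hx.nonneg i, hx.total i, hx.kirchhoff i⟩
  -- Each flow recurs infinitely often. For `n = 0` only Büchi constraints remain, by `hn`, and any
  -- positive flow will do.
  let base : ℕ → A → ℝ := fun l => if h : 0 < n then x ⟨l % n, Nat.mod_lt l h⟩ else y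
  have hbase : ∀ l, M.IsFlow (base l) := fun l => by
    by_cases h : 0 < n
    · simp only [base, h, dite_true]; exact hflow _
    · simp only [base, h, dite_false]; exact hy
  let ε : ℕ → ℝ := fun l => 1 / ((l : ℝ) + 1)
  have hε0 : ∀ l, 0 < ε l := fun l => by positivity
  have hε1 : ∀ l, ε l ≤ 1 := fun l => by
    rw [div_le_one (by positivity)]; linarith [Nat.cast_nonneg (α := ℝ) l]
  have hεlim : Tendsto ε atTop (𝓝 0) := tendsto_one_div_add_atTop_nhds_zero_nat
  let z : ℕ → A → ℝ := fun l a => (1 - ε l) * base l a + ε l * y a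
  have hz : ∀ l, M.IsFlow (z l) := fun l => (hbase l).convex hy (hε0 l).le (hε1 l)
  have hzpos : ∀ l a, 0 < z l a := fun l a =>
    add_pos_of_nonneg_of_pos (mul_nonneg (sub_nonneg.2 (hε1 l)) ((hbase l).nonneg a))
      (mul_pos (hε0 l) (hypos a))
  have hzr : ∀ l (r : S → ℝ), ∑ a, z l a * r (M.src a) =
      (1 - ε l) * ∑ a, base l a * r (M.src a) + ε l * ∑ a, y a * r (M.src a) := fun l r => by
    simp only [z, add_mul, Finset.sum_add_distrib, mul_assoc, ← Finset.mul_sum]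
  obtain ⟨σ, τ, idx, hτ, hlong, hidx, hidx', hσ⟩ := hM.exists_strategy_following hz hzpos
  have hidxlim : Tendsto idx atTop atTop := by
    refine tendsto_atTop.2 fun l => ?_
    filter_upwards [eventually_ge_atTop (τ l)] with t ht
    exact Nat.lt_succ_iff.1 (hτ.lt_iff_lt.1 (ht.trans_lt (hidx t)))
  have hsat : ∀ᵐ ω ∂(M.prob σ), ω ∈ M.Runs σ ∧ acc.Sat fun t => (ω t).last := by
    filter_upwards [M.ae_isTypical σ] with ω hω
    obtain ⟨hrun, act, B, hB, htyp⟩ := hω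
    obtain ⟨hcount, hfreq⟩ := hσ ω act B hB htyp
    refine ⟨hrun, fun i => ?_, fun j => ?_, fun i => ?_⟩
    · obtain ⟨s, hs⟩ := hbuchi i
      obtain ⟨a, ha⟩ := M.act_nonempty s
      refine (hfreq a).mono fun t ht => ?_
      change (ω t).last ∈ acc.buchi i
      rwa [← htyp.src_act, ht, M.mem_act_iff.1 ha]
    · have hn' : 0 < n := Nat.pos_of_ne_zero fun h => by
        have := hn h; subst this; exact j.elim0
      have hne : Nonempty (Fin n) := ⟨⟨0, hn'⟩⟩
      obtain ⟨c, hc⟩ := exists_abs_reward_le (acc.r j)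
      -- The worst flow bounds every phase from below, up to an error that vanishes with `ε`.
      obtain ⟨i, hi⟩ := Finite.exists_min fun i => ∑ a, x i a * acc.r j (M.src a)
      have hi' := hx.reward_inf i j
      rw [M.sum_act fun a s => x i a * acc.r j s] at hi'
      refine hi'.mono ?_
      set l := ∑ a, x i a * acc.r j (M.src a) with hl
      have hlow : ∀ t, l + ε (idx t) * (∑ a, y a * acc.r j (M.src a) - l) ≤
          ∑ a, z (idx t) a * acc.r j (M.src a) := fun t => by
        have h1 : l ≤ ∑ a, base (idx t) a * acc.r j (M.src a) := by
          simp only [base, hn', dite_true]; exact hi _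
        rw [hzr]
        have := mul_le_mul_of_nonneg_left h1 (sub_nonneg.2 (hε1 (idx t)))
        linarith
      have hg : Tendsto (fun t => l + ε (idx t) * (∑ a, y a * acc.r j (M.src a) - l)) atTop
          (𝓝 l) := by
        have := ((hεlim.comp hidxlim).mul_const (∑ a, y a * acc.r j (M.src a) - l)).const_add l
        simpa using this
      have hd := (htyp.tendsto_average_sub hcount (acc.r j)).neg
      rw [neg_zero] at hd
      refine le_lrInf_of_average_le (f := fun t => acc.r j (ω t).last) (fun t => hc _) hg hd
        (Eventually.of_forall fun T => ?_)
      have := div_le_div_of_nonneg_right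
        (Finset.sum_le_sum fun t (_ : t ∈ Finset.range T) => hlow t) (Nat.cast_nonneg (α := ℝ) T)
      linarith
    · have hn' : 0 < n := i.pos
      obtain ⟨c, hc⟩ := exists_abs_reward_le (acc.q i)
      have hi' := hx.reward_sup i
      rw [M.sum_act fun a s => x i a * acc.q i s] at hi'
      refine hi'.mono ?_
      set w : ℕ → ℝ := fun l => ∑ a, z l a * acc.q i (M.src a) with hw
      -- The phases that play `x i`; the shift by one makes their index positive, as the estimate by
      -- `2 * c / l` requires.
      let ψ : ℕ → ℕ := fun p => n * (p + 1) + i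
      have hψ : Tendsto ψ atTop atTop :=
        tendsto_atTop_mono (fun p => by simp only [ψ, id]; nlinarith) tendsto_id
      have hφ : Tendsto (fun p => τ (ψ p + 1)) atTop atTop :=
        hτ.tendsto_atTop.comp ((tendsto_add_atTop_nat 1).comp hψ)
      have hwψ : Tendsto (fun p => w (ψ p)) atTop (𝓝 (∑ a, x i a * acc.q i (M.src a))) := by
        have hb : ∀ p, base (ψ p) = x i := fun p => by
          simp only [base, hn', dite_true, ψ]
          congr 1
          ext
          simp [Nat.mod_eq_of_lt i.2]
        have h1 := (((hεlim.comp hψ).const_sub 1).mul_const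
          (∑ a, x i a * acc.q i (M.src a))).add
          ((hεlim.comp hψ).mul_const (∑ a, y a * acc.q i (M.src a)))
        simp only [sub_zero, one_mul, zero_mul, add_zero] at h1
        refine h1.congr fun p => ?_
        simp only [hw]
        rw [hzr, hb]
        rfl
      have hρ : Tendsto (fun p => (∑ t ∈ Finset.range (τ (ψ p + 1)), w (idx t)) /
          (τ (ψ p + 1) : ℝ) - w (ψ p)) atTop (𝓝 0) := by
        refine squeeze_zero_norm (fun p => ?_)
          ((tendsto_const_div_atTop_nhds_zero_nat (2 * c)).comp hψ)
        exact abs_sum_sub_mul_le hτ hlong (fun t => (hz _).abs_sum_mul_le hc)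
          (fun l t h1 h2 => by rw [hidx' l t h1 h2]) (by simp only [ψ]; nlinarith)
      refine le_lrSup_of_tendsto (f := fun t => acc.q i (ω t).last) (fun t => hc _) hφ ?_
      have h1 := ((htyp.tendsto_average_sub hcount (acc.q i)).comp hφ).add (hρ.add hwψ)
      rw [zero_add, zero_add] at h1
      refine h1.congr fun p => ?_
      simp only [Function.comp_apply, hw]
      ring
  obtain ⟨R, hR1, hR2, hR3⟩ := exists_measurableSet_subset_of_ae hsat
  exact ⟨σ, R, ⟨fun ω hω => (hR3 ω hω).1, hR1, fun ω hω => (hR3 ω hω).2⟩, hR2⟩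

theorem proposition3 {S A : Type*} [Fintype S] [Fintype A] (M : MDP S A)
    (hM : M.StronglyConnected) {k m n : ℕ} (acc : AccCond S k m n)
    (hbuchi : ∀ i, (acc.buchi i).Nonempty) (hn : n = 0 → m = 0) :
    ((∃ x : Fin n → A → ℝ, acc.IsNonnegSolution M x) ↔
      ∃ (σ : M.Strategy) (R : Set (ℕ → Loc S A)), acc.HoldsOn M σ R ∧ M.prob σ R ≠ 0) ∧
    ((∃ (σ : M.Strategy) (R : Set (ℕ → Loc S A)), acc.HoldsOn M σ R ∧ M.prob σ R ≠ 0) →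
      ∃ (σ : M.Strategy) (R : Set (ℕ → Loc S A)), acc.HoldsOn M σ R ∧ M.prob σ R = 1) := by
  refine ⟨⟨fun ⟨x, hx⟩ => ?_, fun ⟨σ, R, hR, hpos⟩ => hR.exists_isNonnegSolution hpos⟩,
    fun ⟨σ, R, hR, hpos⟩ => ?_⟩
  · obtain ⟨σ, R, hR, h1⟩ := hx.exists_strategy hM hbuchi hn
    exact ⟨σ, R, hR, h1 ▸ one_ne_zero⟩
  · obtain ⟨x, hx⟩ := hR.exists_isNonnegSolution hpos
    exact hx.exists_strategy hM hbuchi hn
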